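/- **Setting.** For $q\in\mathbb N$ and $x\in\mathbb R$ let $[x]_q=\lfloor qx\rfloor/q$, applied componentwise to vectors. $H(\cdot)$ and $H(\cdot\mid\cdot)$ denote the discrete (conditional) entropy in bits. The Rényi information dimension (RID) of a probability distribution $\pi$ on $\mathbb R$ is $d(\pi)=\lim_{q\to\infty}H([X]_q)/\log_2 q$, where $X\sim\pi$. A distribution is nonsingular if it is a convex combination of an absolutely continuous and a discrete probability distribution. The Hadamard matrices are $H_1=(1)$, $H_{2N}=\begin{pmatrix}H_N&H_N\\H_N&-H_N\end{pmatrix}$; a partial Hadamard matrix of dimension $m\times N$, $N=2^n$, consists of $m$ distinct rows of $H_N$. A family of matrices $\{\Phi_N\}$, with $\Phi_N$ of dimension $m_N\times N$, is $\epsilon$-REP$(\pi)$ with measurement rate $\rho$ if, for $X_1^N$ i.i.d. with law $\pi$ and $D_1^N=[X_1^N]_q$, $$\limsup_{q\to\infty}\frac{H(D_1^N\mid\Phi_NX_1^N)}{H(D_1^N)}\le\epsilon\ \text{ for every } N \text{ in the index set},\qquad \limsup_{N\to\infty}\frac{m_N}{N}=\rho .$$ It is $\epsilon$-REP$(\Pi)$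 with measurement rate $\rho$, for a class $\Pi$ of distributions, if it is $\epsilon$-REP$(\pi)$ with measurement rate $\rho$ for every $\pi\in\Pi$. **Theorem.** Let $\Pi$ be a class of nonsingular probability distributions on $\mathbb R$ with finite second moment and strictly positive RID. Then the limit defining $d(\pi)$ exists for every $\pi\in\Pi$ and, for every $\epsilon>0$, there is one family $\{\Phi_N\}$, $N=2^n$, $n=0,1,2,\dots$, of partial Hadamard matrices of dimension $m_N\times N$ which is $\epsilon$-REP$(\Pi)$ with measurement rate $$\rho=\limsup_{N\to\infty}\frac{m_N}{N}=\sup_{\pi\in\Pi}d(\pi).$$ (If $\Pi$ is empty, the supremum, taken in $[0,\infty]$, is $0$. A priori, $d(\pi)>0$ is only required with $\lim$ read as $\limsup$.) -/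

import Mathlib

open MeasureTheory ProbabilityTheory Filter Topology
open scoped ENNReal

namespace RIDPolar

noncomputable section

/-- The discrete (Shannon) entropy, in bits, of a discrete probability measure, as an element of
`[0, ∞]`. -/
def shannonEntropy {α : Type*} [MeasurableSpace α] (ν : Measure α) : ℝ≥0∞ :=
  ∑' a : α, ENNReal.ofReal (-(ν.real {a} * Real.logb 2 (ν.real {a})))

/-- The entropy `H(D)` of a discrete random variable `D` on the probability space `(Ω, P)`. -/
def entropy {Ω α : Type*} [MeasurableSpace Ω] [MeasurableSpace α] (D : Ω → α)
    (P : Measure Ω) : ℝ≥0∞ :=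
  shannonEntropy (P.map D)

/-- The conditional entropy `H(D | Y)` of a discrete random variable `D` given an arbitrary random
element `Y`: the average, over the law of `Y`, of the entropy of the regular conditional
distribution of `D` given `Y = y`. -/
def condEntropy {Ω α β : Type*} [MeasurableSpace Ω] [MeasurableSpace α] [StandardBorelSpace α]
    [Nonempty α] [MeasurableSpace β] (D : Ω → α) (Y : Ω → β) (P : Measure Ω)
    [IsFiniteMeasure P] : ℝ≥0∞ :=
  ∫⁻ y, shannonEntropy (condDistrib D Y P y) ∂(P.map Y)

/-- The uniform quantization `[x]_q = ⌊q x⌋ / q` of a real number. -/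
def quantize (q : ℕ) (x : ℝ) : ℝ := (⌊(q : ℝ) * x⌋ : ℝ) / q

/-- The componentwise uniform quantization of a vector. -/
def quantizeVec {N : ℕ} (q : ℕ) (x : Fin N → ℝ) : Fin N → ℝ := fun i => quantize q (x i)

/-- The ratio `H([X]_q) / log₂ q` for a real random variable `X` with law `π`. -/
def ridRatio (π : Measure ℝ) (q : ℕ) : ℝ≥0∞ :=
  entropy (quantize q) π / ENNReal.ofReal (Real.logb 2 q)

/-- The Rényi information dimension `d(π) = lim_q H([X]_q) / log₂ q`, read as the limit superior
(so that it is defined for every law); it is the limit whenever the limit exists. -/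
def rid (π : Measure ℝ) : ℝ≥0∞ := limsup (ridRatio π) atTop

/-- A probability law on `ℝ` is nonsingular if it is a convex combination of an absolutely
continuous and a discrete probability law. -/
def IsNonsingular (π : Measure ℝ) : Prop :=
  ∃ (δ : ℝ) (pc pd : Measure ℝ), 0 ≤ δ ∧ δ ≤ 1 ∧
    IsProbabilityMeasure pc ∧ IsProbabilityMeasure pd ∧
    pc ≪ volume ∧ (∃ s : Set ℝ, s.Countable ∧ pd sᶜ = 0) ∧
    π = ENNReal.ofReal δ • pc + ENNReal.ofReal (1 - δ) • pd

/-- The law of an i.i.d. vector `X_1^N` with marginal law `π`. The random vector `X_1^N` itself is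
the identity on `Fin N → ℝ`. -/
abbrev iidLaw (π : Measure ℝ) (N : ℕ) : Measure (Fin N → ℝ) := Measure.pi fun _ => π

/-- The Hadamard (Sylvester) matrix of order `2 ^ n`:
`H₁ = (1)` and `H_{2N} = [H_N, H_N; H_N, -H_N]`. -/
def hadamard : (n : ℕ) → Matrix (Fin (2 ^ n)) (Fin (2 ^ n)) ℝ
  | 0 => Matrix.of fun _ _ => 1
  | n + 1 =>
    let e : Fin (2 ^ n) ⊕ Fin (2 ^ n) ≃ Fin (2 ^ (n + 1)) :=
      finSumFinEquiv.trans (finCongr (by rw [pow_succ, mul_two]))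
    Matrix.reindex e e
      (Matrix.fromBlocks (hadamard n) (hadamard n) (hadamard n) (-hadamard n))

/-- A partial Hadamard matrix of size `m × 2 ^ n`: one that consists of `m` distinct rows of the
Hadamard matrix, in their order. -/
def IsPartialHadamard {m : ℕ} (n : ℕ) (Φ : Matrix (Fin m) (Fin (2 ^ n)) ℝ) : Prop :=
  ∃ r : Fin m ↪o Fin (2 ^ n), Φ = (hadamard n).submatrix r id

/-- The asymptotic measurement rate `limsup m_N / N` of a family of `m k × N k` matrices. -/
def measurementRate {N m : ℕ → ℕ} (_Φ : ∀ k, Matrix (Fin (m k)) (Fin (N k)) ℝ) : ℝ≥0∞ :=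
  limsup (fun k => (m k : ℝ≥0∞) / (N k : ℝ≥0∞)) atTop

/-- The family `Φ` of matrices, the `k`-th of size `m k × N k`, is `ε`-REP for the law `π` with
measurement rate `ρ`: with `X_1^N` i.i.d. of law `π` and `D_1^N = [X_1^N]_q`, every member of the
family satisfies `limsup_q H(D_1^N | Φ_N X_1^N) / H(D_1^N) ≤ ε`, and the measurement rate
is `ρ`. -/
structure IsREP {N m : ℕ → ℕ} (Φ : ∀ k, Matrix (Fin (m k)) (Fin (N k)) ℝ) (ε : ℝ)
    (π : Measure ℝ) [IsProbabilityMeasure π] (ρ : ℝ≥0∞) : Prop where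
  limsup_le : ∀ k, limsup (fun q : ℕ =>
      condEntropy (quantizeVec q) (fun x => (Φ k).mulVec x) (iidLaw π (N k)) /
        entropy (quantizeVec q) (iidLaw π (N k))) atTop ≤ ENNReal.ofReal ε
  rate_eq : measurementRate Φ = ρ

/-- The family `Φ` is `ε`-REP for a class of laws if it is so for each law of the class. -/
def IsREPClass {N m : ℕ → ℕ} (Φ : ∀ k, Matrix (Fin (m k)) (Fin (N k)) ℝ) (ε : ℝ)
    (Pi : Set (ProbabilityMeasure ℝ)) (ρ : ℝ≥0∞) : Prop :=
  ∀ π ∈ Pi, IsREP Φ ε (π : Measure ℝ) ρ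

end

end RIDPolar

/-! Let δ be the weight of the absolutely continuous part of π. Nearly all of the discrete part sits
on a finite set F. A coordinate in F costs O(1) bits, while one outside F costs about log₂ q bits.
To leading order a coordinate is thus a symbol erased with probability p = π(Fᶜ), which can be
brought as close to δ as desired, and d(π) = δ (`exists_weight`).

Given the set c of erased coordinates, the Hadamard matrix acts as the polar transform of erasure
channels: `erased` marks the rows that the preceding ones leave undetermined. These rows are as many
as the erased coordinates (`sum_erased`) and linearly independent on the columns in c
(`linearIndependent_erased_rows`). If the rows in A are measured, it therefore suffices to supply as
many coordinates as there are erased rows outside A. Knowing these to precision 1/q gives all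
coordinates to precision O(1/q), by linear algebra over ℝ. With z_i(p) the probability that row i is
erased, this yields H(D | ΦX) ≤ log₂ q · Σ_{i ∉ A} z_i(p) + O(1), to be compared with H(D) ≥ N (l
log₂ q - O(1)) for every positive l < δ.

Let d be the supremum of the dimensions and let A be the rows with z_i(d) > η. Polarization gives A
the asymptotic rate d (`tendsto_polarization`). One choice serves the whole class because the odds
of z_i(p), relative to the odds of p, are monotone in p (`erasureProb_odds`): a small z_i(d) forces
z_i(p) to be a small multiple of p for all p ≤ d, so the error is small relative to the entropy even
for laws of small dimension. -/

namespace RIDPolar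

/-! ### Entropy bounds from Gibbs' inequality and codes -/

/-- Pointwise Gibbs inequality. -/
lemma neg_mul_logb_le {p x : ℝ} (hp : 0 ≤ p) (hx : 0 < x) :
    -(p * Real.logb 2 p) ≤ p * -Real.logb 2 x + x / Real.log 2 := by
  have h2 : 0 < Real.log 2 := Real.log_pos one_lt_two
  have key : -(p * Real.log p) ≤ p * -Real.log x + x := by
    rcases hp.eq_or_lt with rfl | hp
    · simpa using hx.le
    · have h := Real.log_le_sub_one_of_pos (div_pos hx hp)
      rw [Real.log_div hx.ne' hp.ne'] at h
      have h' := mul_le_mul_of_nonneg_left h hp.le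
      have h3 : p * (x / p - 1) = x - p := by field_simp
      nlinarith
  simp only [Real.logb]
  calc -(p * (Real.log p / Real.log 2)) = -(p * Real.log p) / Real.log 2 := by ring
    _ ≤ (p * -Real.log x + x) / Real.log 2 := by gcongr
    _ = _ := by ring

lemma tsum_mul_measure_singleton_le {α : Type*} [MeasurableSpace α] [MeasurableSingletonClass α]
    (ν : Measure α) (g : α → ℝ≥0∞) : ∑' a, g a * ν {a} ≤ ∫⁻ a, g a ∂ν := by
  rw [ENNReal.tsum_eq_iSup_sum]
  refine iSup_le fun s => ?_
  rw [← lintegral_finset]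
  exact setLIntegral_le_lintegral _ _

lemma tsum_mul_measure_singleton {α : Type*} [MeasurableSpace α] [MeasurableSingletonClass α]
    (ν : Measure α) (g : α → ℝ≥0∞) {s : Set α} (hs : s.Countable) (hν : ν sᶜ = 0) :
    ∑' a, g a * ν {a} = ∫⁻ a, g a ∂ν := by
  have h1 : ∫⁻ a, g a ∂ν = ∫⁻ a in s, g a ∂ν := by
    rw [Measure.restrict_eq_self_of_ae_mem]
    exact hν
  rw [h1, lintegral_countable _ hs]
  refine (tsum_subtype_eq_of_support_subset (f := fun a => g a * ν {a}) ?_).symm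
  intro a ha
  by_contra hns
  exact ha (by simp [measure_mono_null (Set.singleton_subset_iff.2 hns) hν])

/-- The code length, in bits, of a symbol of weight `x`. -/
noncomputable def bits (x : ℝ≥0∞) : ℝ≥0∞ :=
  if x = 0 then ⊤ else ENNReal.ofReal (-Real.logb 2 x.toReal)

lemma measurable_bits : Measurable bits :=
  Measurable.ite (measurableSet_singleton _) measurable_const
    (ENNReal.measurable_ofReal.comp
      ((Real.measurable_log.comp ENNReal.measurable_toReal).div_const _).neg)

lemma bits_le {x : ℝ≥0∞} {w : ℝ} (hw : 0 < w) (hx : x ≠ ⊤) (h : ENNReal.ofReal w ≤ x) :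
    bits x ≤ ENNReal.ofReal (-Real.logb 2 w) := by
  have hx0 : x ≠ 0 := fun h0 => by
    rw [h0, nonpos_iff_eq_zero, ENNReal.ofReal_eq_zero] at h
    exact absurd hw (not_lt.2 h)
  rw [bits, if_neg hx0]
  refine ENNReal.ofReal_le_ofReal (neg_le_neg (Real.logb_le_logb_of_le one_lt_two hw ?_))
  rwa [← ENNReal.ofReal_le_iff_le_toReal hx]

/-- Gibbs' inequality summed over the atoms. Since Q need not be normalized, its total mass enters
as an additive constant, harmless after division by log₂ q. -/
lemma shannonEntropy_le_lintegral_bits {α : Type*} [MeasurableSpace α]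
    [MeasurableSingletonClass α] (ν : Measure α) [IsProbabilityMeasure ν] (Q : α → ℝ≥0∞)
    (hQ : ∀ a, Q a ≠ ⊤) :
    shannonEntropy ν ≤ ∫⁻ a, bits (Q a) ∂ν + (∑' a, Q a) * ENNReal.ofReal (1 / Real.log 2) := by
  have h2 : 0 < Real.log 2 := Real.log_pos one_lt_two
  refine le_trans ?_ (add_le_add_left (tsum_mul_measure_singleton_le ν _) _)
  rw [← ENNReal.tsum_mul_right, ← ENNReal.tsum_add]
  refine ENNReal.tsum_le_tsum fun a => ?_
  rcases eq_or_ne (Q a) 0 with h0 | h0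
  · rcases eq_or_ne (ν {a}) 0 with h1 | h1
    · simp [measureReal_def, h1]
    · simp [bits, h0, h1]
  have hx : 0 < (Q a).toReal := ENNReal.toReal_pos h0 (hQ a)
  have hν : ν {a} = ENNReal.ofReal (ν.real {a}) := by simp [measureReal_def]
  calc _ ≤ ENNReal.ofReal (ν.real {a} * -Real.logb 2 (Q a).toReal + (Q a).toReal / Real.log 2) :=
        ENNReal.ofReal_le_ofReal (neg_mul_logb_le measureReal_nonneg hx)
    _ ≤ ENNReal.ofReal (ν.real {a} * -Real.logb 2 (Q a).toReal) +
          ENNReal.ofReal ((Q a).toReal / Real.log 2) := ENNReal.ofReal_add_le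
    _ = _ := by
      rw [bits, if_neg h0, ENNReal.ofReal_mul measureReal_nonneg, ← hν, mul_comm, div_eq_mul_one_div,
        ENNReal.ofReal_mul hx.le, ENNReal.ofReal_toReal (hQ a)]

/-- A bound of the conditional entropy by the mean length of a description of `D` by a codeword
that can be decoded with the help of `Y`. -/
lemma condEntropy_le_of_code {Ω α β κ : Type*} [MeasurableSpace Ω] [MeasurableSpace α]
    [StandardBorelSpace α] [Nonempty α] [MeasurableSpace β] [Countable κ] {P : Measure Ω}
    [IsProbabilityMeasure P] {D : Ω → α} {Y : Ω → β} (hD : Measurable D) (hY : Measurable Y)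
    (w : κ → ℝ) (hw : ∀ k, 0 < w k) {S : ℝ≥0∞} (hS : S ≠ ⊤)
    (hwS : ∑' k, ENNReal.ofReal (w k) ≤ S) (dec : β → κ → α)
    (hdec : ∀ k, Measurable fun y => dec y k) (enc : Ω → κ) (henc : ∀ ω, D ω = dec (Y ω) (enc ω)) :
    condEntropy D Y P ≤ ∫⁻ ω, ENNReal.ofReal (-Real.logb 2 (w (enc ω))) ∂P +
      S * ENNReal.ofReal (1 / Real.log 2) := by
  classical
  have : IsProbabilityMeasure (P.map Y) := Measure.isProbabilityMeasure_map hY.aemeasurable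
  -- Q (y, d) is the total weight of the codewords that decode to d when Y = y. Only Q has to be
  -- measurable; the encoder enters through a pointwise bound and need not be.
  let Q : β × α → ℝ≥0∞ := fun p =>
    ∑' k, {p : β × α | dec p.1 k = p.2}.indicator (fun _ => ENNReal.ofReal (w k)) p
  have hQm : Measurable Q := Measurable.tsum fun k =>
    measurable_const.indicator
      (measurableSet_eq_fun ((hdec k).comp measurable_fst) measurable_snd)
  have hQS : ∀ p, Q p ≤ S := fun p =>
    (ENNReal.tsum_le_tsum fun k => Set.indicator_le_self _ _ _).trans hwS
  have hQtop : ∀ p, Q p ≠ ⊤ := fun p => ne_top_of_le_ne_top hS (hQS p)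
  have hQsum : ∀ y, ∑' d, Q (y, d) ≤ S := fun y => by
    rw [ENNReal.tsum_comm]
    refine (ENNReal.tsum_le_tsum fun k => ?_).trans hwS
    rw [tsum_eq_single (dec y k)]
    · exact Set.indicator_le_self _ _ _
    · intro d hd
      exact Set.indicator_of_notMem (fun h => hd h.symm) _
  have hpt : ∀ ω, bits (Q (Y ω, D ω)) ≤ ENNReal.ofReal (-Real.logb 2 (w (enc ω))) := fun ω => by
    refine bits_le (hw _) (hQtop _) ?_
    refine le_trans ?_ (ENNReal.le_tsum (enc ω))
    rw [Set.indicator_of_mem (show (Y ω, D ω) ∈ {p : β × α | dec p.1 (enc ω) = p.2} from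
      (henc ω).symm)]
  calc condEntropy D Y P
      ≤ ∫⁻ y, (∫⁻ d, bits (Q (y, d)) ∂(condDistrib D Y P y) +
          S * ENNReal.ofReal (1 / Real.log 2)) ∂(P.map Y) :=
        lintegral_mono fun y => (shannonEntropy_le_lintegral_bits _ (fun d => Q (y, d))
          fun d => hQtop _).trans (by gcongr; exact hQsum y)
    _ = ∫⁻ ω, bits (Q (Y ω, D ω)) ∂P + S * ENNReal.ofReal (1 / Real.log 2) := by
        rw [lintegral_add_right _ measurable_const, lintegral_const, measure_univ, mul_one,
          ← Measure.lintegral_compProd (f := fun p => bits (Q p)) (measurable_bits.comp hQm),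
          compProd_map_condDistrib hD.aemeasurable,
          lintegral_map (f := fun p => bits (Q p)) (measurable_bits.comp hQm) (hY.prodMk hD)]
    _ ≤ _ := by gcongr with ω; exact hpt ω

/-- Applied to a matrix without rows, this turns the conditional upper bound into one for the
entropy of a single quantized coordinate. -/
lemma condEntropy_of_subsingleton {Ω α β : Type*} [MeasurableSpace Ω] [MeasurableSpace α]
    [StandardBorelSpace α] [Nonempty α] [MeasurableSpace β] [Unique β] {P : Measure Ω}
    [IsProbabilityMeasure P] {D : Ω → α} {Y : Ω → β} (hD : Measurable D) (hY : Measurable Y) :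
    condEntropy D Y P = entropy D P := by
  have : IsProbabilityMeasure (P.map Y) := Measure.isProbabilityMeasure_map hY.aemeasurable
  have h1 : P.map Y = Measure.dirac default := by
    ext s hs
    rcases s.eq_empty_or_nonempty.imp_right Subsingleton.eq_univ_of_nonempty with rfl | rfl <;> simp
  have h2 := condDistrib_comp_map (μ := P) (X := Y) (Y := D) hY.aemeasurable hD.aemeasurable
  rw [h1, Measure.dirac_bind (Kernel.measurable _)] at h2
  rw [condEntropy, lintegral_unique, measure_univ, mul_one, h2, entropy]

/-! ### Quantization and the entropy of product laws -/

lemma measurable_quantize (q : ℕ) : Measurable (quantize q) := by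
  unfold quantize
  exact ((measurable_from_top (f := fun n : ℤ => (n : ℝ))).comp
    (Int.measurable_floor.comp (measurable_const_mul _))).div_const _

lemma measurable_quantizeVec {N : ℕ} (q : ℕ) : Measurable (quantizeVec (N := N) q) :=
  measurable_pi_lambda _ fun i => (measurable_quantize q).comp (measurable_pi_apply i)

lemma countable_range_quantize (q : ℕ) : (Set.range (quantize q)).Countable := by
  refine (Set.countable_range fun n : ℤ => (n : ℝ) / q).mono ?_
  rintro _ ⟨x, rfl⟩
  exact ⟨_, rfl⟩

lemma map_quantize_compl_range (ν : Measure ℝ) (q : ℕ) :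
    ν.map (quantize q) (Set.range (quantize q))ᶜ = 0 := by
  rw [Measure.map_apply (measurable_quantize q) (countable_range_quantize q).measurableSet.compl]
  convert measure_empty (μ := ν)
  ext x
  simp

lemma ofReal_neg_mul_logb {α : Type*} [MeasurableSpace α] (ν : Measure α) [IsFiniteMeasure ν]
    (a : α) : ENNReal.ofReal (-(ν.real {a} * Real.logb 2 (ν.real {a}))) =
      ENNReal.ofReal (-Real.logb 2 (ν.real {a})) * ν {a} := by
  rw [← mul_neg, ENNReal.ofReal_mul measureReal_nonneg, mul_comm]
  simp [measureReal_def]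

lemma shannonEntropy_eq_lintegral {α : Type*} [MeasurableSpace α] [MeasurableSingletonClass α]
    (ν : Measure α) [IsFiniteMeasure ν] {s : Set α} (hs : s.Countable) (hν : ν sᶜ = 0) :
    shannonEntropy ν = ∫⁻ a, ENNReal.ofReal (-Real.logb 2 (ν.real {a})) ∂ν := by
  rw [← tsum_mul_measure_singleton ν _ hs hν]
  exact tsum_congr fun a => ofReal_neg_mul_logb ν a

lemma measurable_measureReal_singleton {α : Type*} [MeasurableSpace α] [MeasurableEq α]
    (ν : Measure α) [IsFiniteMeasure ν] :
    Measurable fun a => ν.real {a} := by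
  have h := measurable_measure_prodMk_left (ν := ν) (s := {p : α × α | p.1 = p.2})
    measurableSet_diagonal
  convert ENNReal.measurable_toReal.comp h using 1
  ext a
  simp only [Function.comp, measureReal_def]
  congr 2
  ext b
  simp [eq_comm]

/-- The information -log₂ of a point mass is additive over independent coordinates. Only this
inequality is needed, since the entropy of the vector occurs in a denominator. -/
lemma shannonEntropy_pi_ge {N : ℕ} (ν : Measure ℝ) [IsProbabilityMeasure ν] {s : Set ℝ}
    (hs : s.Countable) (hν : ν sᶜ = 0) :
    (N : ℝ≥0∞) * shannonEntropy ν ≤ shannonEntropy (Measure.pi fun _ : Fin N => ν) := by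
  classical
  set μ := Measure.pi fun _ : Fin N => ν
  -- The logarithm of a product splits only for nonzero factors; points of mass zero form a null set
  -- because ν lives on the countable set s.
  have hpos : ∀ᵐ a ∂ν, 0 < ν.real {a} := by
    have hz : ν {a | ν.real {a} = 0} = 0 := by
      have h1 : ν {a | ν.real {a} = 0} ≤ ν ({a | ν.real {a} = 0} ∩ s) + ν sᶜ := by
        refine (measure_mono fun a ha => ?_).trans (measure_union_le _ _)
        by_cases h : a ∈ s
        · exact Or.inl ⟨ha, h⟩
        · exact Or.inr h
      have h2 : ν ({a | ν.real {a} = 0} ∩ s) = 0 := by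
        refine (measure_null_iff_singleton (hs.mono Set.inter_subset_right)).2 fun a ha => ?_
        exact (measureReal_eq_zero_iff (measure_ne_top _ _)).1 ha.1
      simpa [h2, hν] using h1
    filter_upwards [measure_eq_zero_iff_ae_notMem.1 hz] with a ha
    exact lt_of_le_of_ne measureReal_nonneg (Ne.symm ha)
  have hae : ∀ i : Fin N, ∀ᵐ x ∂μ, 0 < ν.real {x i} := fun i =>
    (measurePreserving_eval (fun _ : Fin N => ν) i).quasiMeasurePreserving.ae hpos
  have hm : Measurable fun a => ENNReal.ofReal (-Real.logb 2 (ν.real {a})) :=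
    ENNReal.measurable_ofReal.comp
      ((Real.measurable_log.comp (measurable_measureReal_singleton ν)).div_const _).neg
  have hsN : (Set.univ.pi fun _ : Fin N => s).Countable := Set.countable_univ_pi fun _ => hs
  have hμ : μ (Set.univ.pi fun _ : Fin N => s)ᶜ = 0 := by
    have : ∀ᵐ x ∂μ, ∀ i, x i ∈ s := ae_all_iff.2 fun i =>
      (measurePreserving_eval (fun _ : Fin N => ν) i).quasiMeasurePreserving.ae
        (show ∀ᵐ a ∂ν, a ∈ s from hν)
    filter_upwards [this] with x hx i _ using hx i
  rw [shannonEntropy_eq_lintegral μ hsN hμ, shannonEntropy_eq_lintegral ν hs hν]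
  have hsum : ∀ᵐ x ∂μ, ENNReal.ofReal (-Real.logb 2 (μ.real {x})) =
      ∑ i, ENNReal.ofReal (-Real.logb 2 (ν.real {x i})) := by
    filter_upwards [ae_all_iff.2 hae] with x hx
    rw [← ENNReal.ofReal_sum_of_nonneg]
    · congr 1
      rw [Finset.sum_neg_distrib]
      congr 1
      have : μ.real {x} = ∏ i, ν.real {x i} := by
        simp [μ, measureReal_def, Measure.pi_singleton, ENNReal.toReal_prod]
      rw [this, Real.logb_prod _ _ fun i _ => (hx i).ne']
    · intro i _
      exact neg_nonneg.2 (Real.logb_nonpos one_lt_two measureReal_nonneg measureReal_le_one)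
  rw [lintegral_congr_ae hsum, lintegral_finsetSum
    (f := fun i (x : Fin N → ℝ) => ENNReal.ofReal (-Real.logb 2 (ν.real {x i}))) _
    fun i _ => hm.comp (measurable_pi_apply i)]
  have : ∀ i : Fin N, ∫⁻ x, ENNReal.ofReal (-Real.logb 2 (ν.real {x i})) ∂μ =
      ∫⁻ a, ENNReal.ofReal (-Real.logb 2 (ν.real {a})) ∂ν := fun i =>
    (measurePreserving_eval (fun _ : Fin N => ν) i).lintegral_comp hm
  simp [this]

lemma entropy_quantizeVec_ge (π : Measure ℝ) [IsProbabilityMeasure π] (N q : ℕ) :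
    (N : ℝ≥0∞) * entropy (quantize q) π ≤ entropy (quantizeVec q) (iidLaw π N) := by
  have : IsProbabilityMeasure (π.map (quantize q)) :=
    Measure.isProbabilityMeasure_map (measurable_quantize q).aemeasurable
  have h := Measure.pi_map_pi (μ := fun _ : Fin N => π) (f := fun _ => quantize q)
    fun _ => (measurable_quantize q).aemeasurable
  have h' : (iidLaw π N).map (quantizeVec q) = Measure.pi fun _ => π.map (quantize q) := h
  rw [entropy, entropy, h']
  exact shannonEntropy_pi_ge _ (countable_range_quantize q) (map_quantize_compl_range π q)

/-! ### Hadamard matrices and erasure patterns -/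

/-- The indices of `H_{2N}` as two copies of those of `H_N`. -/
def blockEquiv (n : ℕ) : Fin (2 ^ n) ⊕ Fin (2 ^ n) ≃ Fin (2 ^ (n + 1)) :=
  finSumFinEquiv.trans (finCongr (by rw [pow_succ, mul_two]))

lemma hadamard_succ (n : ℕ) (s t : Fin (2 ^ n) ⊕ Fin (2 ^ n)) :
    hadamard (n + 1) (blockEquiv n s) (blockEquiv n t) =
      Matrix.fromBlocks (hadamard n) (hadamard n) (hadamard n) (-hadamard n) s t := by
  change Matrix.reindex (blockEquiv n) (blockEquiv n) _ _ _ = _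
  simp

lemma sum_block {M : Type*} [AddCommMonoid M] {n : ℕ} (f : Fin (2 ^ (n + 1)) → M) :
    ∑ i, f i = ∑ j, f (blockEquiv n (Sum.inl j)) + ∑ j, f (blockEquiv n (Sum.inr j)) := by
  rw [← Fintype.sum_sum_type fun s => f (blockEquiv n s), Equiv.sum_comp]

/-- With `c` the set of the unknown coordinates of `x`, whether the `i`-th entry of `H x` is
undetermined by the entries that precede it in the bit-reversed order. -/
def erased : (n : ℕ) → Fin (2 ^ n) → (Fin (2 ^ n) → Bool) → Bool
  | 0, i, c => c i
  | n + 1, i, c =>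
    Sum.elim
      (fun j => erased n j (fun k => c (blockEquiv n (Sum.inl k))) ||
        erased n j (fun k => c (blockEquiv n (Sum.inr k))))
      (fun j => erased n j (fun k => c (blockEquiv n (Sum.inl k))) &&
        erased n j (fun k => c (blockEquiv n (Sum.inr k))))
      ((blockEquiv n).symm i)

/-- Position in the bit-reversed order. -/
def bitRev : (n : ℕ) → Fin (2 ^ n) → ℕ
  | 0, _ => 0
  | n + 1, i => Sum.elim (fun j => 2 * bitRev n j) (fun j => 2 * bitRev n j + 1)
      ((blockEquiv n).symm i)

/-- In a linear relation between the rows of the Hadamard matrix restricted to the columns in `c`,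
the last row is not an erased one. -/
lemma erased_eq_false_of_relation (n : ℕ) (c : Fin (2 ^ n) → Bool) (γ : Fin (2 ^ n) → ℝ)
    (hγ : ∀ l, c l = true → ∑ k, γ k * hadamard n k l = 0) (i : Fin (2 ^ n)) (hi : γ i ≠ 0)
    (hlast : ∀ k, bitRev n i < bitRev n k → γ k = 0) : erased n i c = false := by
  induction n with
  | zero =>
    by_contra h
    have h1 : c i = true := by simpa [erased] using h
    have h2 := hγ i h1
    have : (Finset.univ : Finset (Fin (2 ^ 0))) = {i} := by
      ext k
      exact iff_of_true (Finset.mem_univ _)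
        (Finset.mem_singleton.2 (Subsingleton.elim (α := Fin 1) k i))
    rw [this, Finset.sum_singleton] at h2
    simp [hadamard, hi] at h2
  | succ n ih =>
    -- By the block form, the left columns see only α + β and the right columns only α - β, which
    -- gives two relations of half the order.
    set α : Fin (2 ^ n) → ℝ := fun k => γ (blockEquiv n (Sum.inl k)) with hα
    set β : Fin (2 ^ n) → ℝ := fun k => γ (blockEquiv n (Sum.inr k)) with hβ
    have h1 : ∀ l, c (blockEquiv n (Sum.inl l)) = true →
        ∑ k, (α k + β k) * hadamard n k l = 0 := fun l hl => by
      have := hγ _ hl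
      rw [sum_block] at this
      simp only [hadamard_succ, Matrix.fromBlocks_apply₁₁, Matrix.fromBlocks_apply₂₁] at this
      simpa only [add_mul, Finset.sum_add_distrib] using this
    have h2 : ∀ l, c (blockEquiv n (Sum.inr l)) = true →
        ∑ k, (α k - β k) * hadamard n k l = 0 := fun l hl => by
      have := hγ _ hl
      rw [sum_block] at this
      simp only [hadamard_succ, Matrix.fromBlocks_apply₁₂, Matrix.fromBlocks_apply₂₂,
        Matrix.neg_apply, mul_neg, Finset.sum_neg_distrib, ← sub_eq_add_neg] at this
      simpa only [sub_mul, Finset.sum_sub_distrib] using this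
    obtain ⟨s, rfl⟩ := (blockEquiv n).surjective i
    have key : ∀ j : Fin (2 ^ n), bitRev (n + 1) (blockEquiv n s) ≤ 2 * bitRev n j + 1 →
        ∀ k, bitRev n j < bitRev n k → α k = 0 ∧ β k = 0 := fun j hj k hk =>
      ⟨hlast _ (hj.trans_lt (by simp [bitRev]; omega)),
        hlast _ (hj.trans_lt (by simp [bitRev]; omega))⟩
    have fin1 : ∀ j : Fin (2 ^ n), bitRev (n + 1) (blockEquiv n s) ≤ 2 * bitRev n j + 1 →
        α j + β j ≠ 0 → erased n j (fun k => c (blockEquiv n (Sum.inl k))) = false :=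
      fun j hj h => ih _ _ h1 j h fun k hk => by
        obtain ⟨ha, hb⟩ := key j hj k hk
        simp [ha, hb]
    have fin2 : ∀ j : Fin (2 ^ n), bitRev (n + 1) (blockEquiv n s) ≤ 2 * bitRev n j + 1 →
        α j - β j ≠ 0 → erased n j (fun k => c (blockEquiv n (Sum.inr k))) = false :=
      fun j hj h => ih _ _ h2 j h fun k hk => by
        obtain ⟨ha, hb⟩ := key j hj k hk
        simp [ha, hb]
    -- In bit-reversed order the two copies of j are adjacent. If the upper one is last, then β j =
    -- 0 and both α ± β are nonzero at j, so neither half is erased and the "or" is false. If the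
    -- lower one is last, then β j ≠ 0, so one of α ± β is nonzero at j and the "and" is false.
    rcases s with j | j
    · have hj : bitRev (n + 1) (blockEquiv n (Sum.inl j)) ≤ 2 * bitRev n j + 1 := by
        simp [bitRev]
      have hb : β j = 0 := hlast _ (by simp [bitRev])
      have ha : α j ≠ 0 := hi
      simp [erased, fin1 j hj (by simpa [hb] using ha), fin2 j hj (by simpa [hb] using ha)]
    · have hj : bitRev (n + 1) (blockEquiv n (Sum.inr j)) ≤ 2 * bitRev n j + 1 := by
        simp [bitRev]
      have hb : β j ≠ 0 := hi
      by_cases h : α j + β j = 0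
      · have h' : α j - β j ≠ 0 := fun h' => hb (by linarith)
        simp [erased, fin2 j hj h']
      · simp [erased, fin1 j hj h]

/-- Each step replaces a pair of bits by their "or" and their "and", which preserves the sum. -/
lemma sum_erased (n : ℕ) (c : Fin (2 ^ n) → Bool) :
    ∑ i, (erased n i c).toNat = ∑ i, (c i).toNat := by
  induction n with
  | zero => rfl
  | succ n ih =>
    rw [sum_block, sum_block fun i => (c i).toNat, ← ih fun k => c (blockEquiv n (Sum.inl k)),
      ← ih fun k => c (blockEquiv n (Sum.inr k)), ← Finset.sum_add_distrib,
      ← Finset.sum_add_distrib]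
    refine Finset.sum_congr rfl fun j _ => ?_
    simp only [erased, Equiv.symm_apply_apply, Sum.elim_inl, Sum.elim_inr]
    cases erased n j fun k => c (blockEquiv n (Sum.inl k)) <;>
      cases erased n j fun k => c (blockEquiv n (Sum.inr k)) <;> rfl

lemma card_filter_eq_sum_toNat {ι : Type*} (s : Finset ι) (f : ι → Bool) :
    (s.filter fun i => f i = true).card = ∑ i ∈ s, (f i).toNat := by
  rw [Finset.card_filter]
  refine Finset.sum_congr rfl fun i _ => ?_
  cases f i <;> rfl

/-- In a nontrivial relation between erased rows, the last row with nonzero coefficient would not be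
erased, by `erased_eq_false_of_relation`. -/
lemma linearIndependent_erased_rows (n : ℕ) (c : Fin (2 ^ n) → Bool) :
    LinearIndependent ℝ (fun (i : {i // erased n i c = true}) (l : {l // c l = true}) =>
      hadamard n i l) := by
  rw [Fintype.linearIndependent_iff]
  intro g hg
  by_contra! hne
  let γ : Fin (2 ^ n) → ℝ := fun k => if h : erased n k c = true then g ⟨k, h⟩ else 0
  obtain ⟨i₀, hi₀⟩ := hne
  have hS : (Finset.univ.filter fun k => γ k ≠ 0).Nonempty :=
    ⟨i₀, by simp [γ, i₀.2, hi₀]⟩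
  obtain ⟨i, hi, hmax⟩ := Finset.exists_max_image _ (bitRev n) hS
  have hi' : γ i ≠ 0 := (Finset.mem_filter.1 hi).2
  have hE : erased n i c = true := by
    by_contra h
    exact hi' (by simp [γ, h])
  have := erased_eq_false_of_relation n c γ (fun l hl => ?_) i hi' (fun k hk => ?_)
  · simp [hE] at this
  · have h1 := congrFun hg ⟨l, hl⟩
    simp only [Finset.sum_apply, Pi.smul_apply, smul_eq_mul, Pi.zero_apply] at h1
    rw [← h1]
    refine (Fintype.sum_of_injective _ Subtype.val_injective _ _ (fun k hk => ?_) fun k => ?_).symm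
    · have : ¬ erased n k c = true := fun h => hk ⟨⟨k, h⟩, rfl⟩
      simp [γ, this]
    · simp [γ, k.2]
  · by_contra h
    exact absurd (hmax k (by simp [h])) (not_le.2 hk)

/-- The coordinates in `c` can be recovered from `Φ x`, the coordinates outside `c`, and
`|c| - rank` of the coordinates in `c`. -/
lemma exists_recovery_set {m N : ℕ} (Φ : Matrix (Fin m) (Fin N) ℝ) (c : Fin N → Bool) :
    ∃ J : Finset (Fin N),
      (∀ x : Fin N → ℝ, Φ.mulVec x = 0 → (∀ i, c i = false ∨ i ∈ J → x i = 0) → x = 0) ∧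
      J.card + (Φ.submatrix id (Subtype.val : {l // c l = true} → Fin N)).rank ≤
        ∑ i, (c i).toNat := by
  classical
  obtain ⟨κ, a, ha, hspan, hli⟩ := exists_linearIndependent' ℝ
    (Φ.submatrix id (Subtype.val : {l // c l = true} → Fin N)).col
  have : Finite κ := Finite.of_injective a ha
  have := Fintype.ofFinite κ
  have hrank : (Φ.submatrix id (Subtype.val : {l // c l = true} → Fin N)).rank =
      Fintype.card κ := by
    rw [Matrix.rank_eq_finrank_span_cols, ← hspan, finrank_span_eq_card hli]
  have hinj : Function.Injective fun k => (a k : Fin N) := Subtype.val_injective.comp ha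
  let I : Finset (Fin N) := Finset.univ.image fun k => (a k : Fin N)
  have hI : I.card = Fintype.card κ := by
    rw [Finset.card_image_of_injective _ hinj, Finset.card_univ]
  have hIc : I ⊆ Finset.univ.filter fun l => c l = true := by
    intro l hl
    obtain ⟨k, _, rfl⟩ := Finset.mem_image.1 hl
    simpa using (a k).2
  -- I indexes a basis of the span of the columns in c. Once x vanishes off I, the equation Φ x = 0
  -- is a linear relation between these basis columns.
  refine ⟨(Finset.univ.filter fun l => c l = true) \ I, fun x hx h0 => ?_, ?_⟩
  · have hz : ∀ i, i ∉ I → x i = 0 := fun i hi => h0 i (by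
      cases hc : c i
      · exact Or.inl rfl
      · exact Or.inr (by simp [hc, hi]))
    have hk := Fintype.linearIndependent_iff.1 hli (fun k => x (a k)) (by
      ext r
      have h1 := congrFun hx r
      simp only [Matrix.mulVec, dotProduct, Pi.zero_apply] at h1
      rw [← Finset.sum_subset (Finset.subset_univ I) (fun i _ hi => by simp [hz i hi]),
        Finset.sum_image hinj.injOn] at h1
      simp only [Finset.sum_apply, Pi.smul_apply, smul_eq_mul, Pi.zero_apply]
      rw [← h1]
      exact Finset.sum_congr rfl fun k _ => mul_comm _ _)
    ext i
    by_cases hi : i ∈ I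
    · obtain ⟨k, _, rfl⟩ := Finset.mem_image.1 hi
      exact hk k
    · exact hz i hi
  · rw [hrank, ← hI, Finset.card_sdiff_add_card_eq_card hIc, card_filter_eq_sum_toNat]

/-- A subset of the rows of the Hadamard matrix determines the vector up to as many of its
unknown coordinates as there are erased rows outside the subset. -/
lemma exists_hadamard_recovery_set (n : ℕ) (A : Finset (Fin (2 ^ n))) (c : Fin (2 ^ n) → Bool) :
    ∃ J : Finset (Fin (2 ^ n)),
      (∀ x : Fin (2 ^ n) → ℝ, ((hadamard n).submatrix (A.orderEmbOfFin rfl) id).mulVec x = 0 →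
        (∀ i, c i = false ∨ i ∈ J → x i = 0) → x = 0) ∧
      J.card ≤ ∑ i ∈ Aᶜ, (erased n i c).toNat := by
  classical
  obtain ⟨J, hJ, hcard⟩ :=
    exists_recovery_set ((hadamard n).submatrix (A.orderEmbOfFin rfl) id) c
  refine ⟨J, hJ, ?_⟩
  set M := ((hadamard n).submatrix (A.orderEmbOfFin rfl) id).submatrix id
    (Subtype.val : {l // c l = true} → Fin (2 ^ n))
  let B := A.filter fun i => erased n i c = true
  have hB : B.card ≤ M.rank := by
    have hmem : ∀ i : B, ∃ k, A.orderEmbOfFin rfl k = i := fun i => by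
      have : (i : Fin (2 ^ n)) ∈ Set.range (A.orderEmbOfFin rfl) := by
        rw [Finset.range_orderEmbOfFin]
        exact (Finset.mem_filter.1 i.2).1
      exact this
    choose r hr using hmem
    have hli : LinearIndependent ℝ (M.submatrix r id).row := by
      have h := (linearIndependent_erased_rows n c).comp
        (fun i : B => ⟨i, (Finset.mem_filter.1 i.2).2⟩)
        (fun i j hij => Subtype.ext (Subtype.mk.inj hij))
      convert h using 1
      ext i l
      simp [M, Matrix.row, hr]
    have h1 := hli.rank_matrix
    rw [Fintype.card_coe] at h1
    exact h1 ▸ Matrix.rank_submatrix_le M r id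
  have h2 : ∑ i ∈ A, (erased n i c).toNat = B.card := (card_filter_eq_sum_toNat A _).symm
  -- The erased rows in A bound the rank from below, and |c| counts all erased rows; the difference
  -- counts those outside A.
  have h3 := Finset.sum_add_sum_compl A fun i => (erased n i c).toNat
  rw [sum_erased] at h3
  omega

/-! ### Polarization of the erasure probabilities and choice of the rows -/

/-- The probability of the pattern `c` when its entries are i.i.d. Bernoulli of parameter `p`. -/
def bernoulliWeight {ι : Type*} [Fintype ι] (p : ℝ) (c : ι → Bool) : ℝ :=
  ∏ i, if c i = true then p else 1 - p

lemma bernoulliWeight_nonneg {ι : Type*} [Fintype ι] {p : ℝ} (h0 : 0 ≤ p) (h1 : p ≤ 1)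
    (c : ι → Bool) : 0 ≤ bernoulliWeight p c :=
  Finset.prod_nonneg fun i _ => by split_ifs <;> linarith

lemma sum_bernoulliWeight (ι : Type*) [Fintype ι] [DecidableEq ι] (p : ℝ) :
    ∑ c : ι → Bool, bernoulliWeight p c = 1 := by
  simp only [bernoulliWeight]
  rw [← Fintype.prod_sum (κ := fun _ : ι => Bool) fun _ b => if b = true then p else 1 - p]
  simp

lemma sum_bernoulliWeight_block (n : ℕ) (p : ℝ)
    (F : (Fin (2 ^ n) → Bool) → (Fin (2 ^ n) → Bool) → ℝ) :
    ∑ c : Fin (2 ^ (n + 1)) → Bool, bernoulliWeight p c *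
      F (fun k => c (blockEquiv n (Sum.inl k))) (fun k => c (blockEquiv n (Sum.inr k))) =
    ∑ c₁, ∑ c₂, bernoulliWeight p c₁ * bernoulliWeight p c₂ * F c₁ c₂ := by
  rw [← Fintype.sum_prod_type' fun c₁ c₂ => bernoulliWeight p c₁ * bernoulliWeight p c₂ * F c₁ c₂]
  refine Fintype.sum_equiv (((blockEquiv n).arrowCongr (Equiv.refl Bool)).symm.trans
    (Equiv.sumArrowEquivProdArrow _ _ _)) _ _ fun c => ?_
  have : bernoulliWeight p c = bernoulliWeight p (fun k => c (blockEquiv n (Sum.inl k))) *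
      bernoulliWeight p (fun k => c (blockEquiv n (Sum.inr k))) := by
    simp only [bernoulliWeight]
    rw [← Equiv.prod_comp (blockEquiv n), Fintype.prod_sum_type]
  rw [this]
  rfl

/-- The erasure probabilities of the polarized binary erasure channels. -/
def erasureProb : (n : ℕ) → Fin (2 ^ n) → ℝ → ℝ
  | 0, _, p => p
  | n + 1, i, p => Sum.elim (fun j => 2 * erasureProb n j p - erasureProb n j p ^ 2)
      (fun j => erasureProb n j p ^ 2) ((blockEquiv n).symm i)

lemma erasureProb_inl (n : ℕ) (j : Fin (2 ^ n)) (p : ℝ) :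
    erasureProb (n + 1) (blockEquiv n (Sum.inl j)) p =
      2 * erasureProb n j p - erasureProb n j p ^ 2 := by
  simp [erasureProb]

lemma erasureProb_inr (n : ℕ) (j : Fin (2 ^ n)) (p : ℝ) :
    erasureProb (n + 1) (blockEquiv n (Sum.inr j)) p = erasureProb n j p ^ 2 := by
  simp [erasureProb]

/-- The two halves of the pattern are independent, so "or" turns a probability z into 2z - z² and
"and" turns it into z². -/
lemma sum_bernoulliWeight_erased (n : ℕ) (i : Fin (2 ^ n)) (p : ℝ) :
    ∑ c, bernoulliWeight p c * ((erased n i c).toNat : ℝ) = erasureProb n i p := by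
  induction n with
  | zero =>
    change ∑ c : Fin 1 → Bool, bernoulliWeight p c * ((c i).toNat : ℝ) = p
    rw [← Equiv.sum_comp (Equiv.funUnique (Fin 1) Bool).symm]
    simp [bernoulliWeight]
  | succ n ih =>
    have hsum := sum_bernoulliWeight (Fin (2 ^ n)) p
    obtain ⟨s, rfl⟩ := (blockEquiv n).surjective i
    rcases s with j | j
    · have h : ∀ c, ((erased (n + 1) (blockEquiv n (Sum.inl j)) c).toNat : ℝ) =
          ((erased n j (fun k => c (blockEquiv n (Sum.inl k)))).toNat : ℝ) +
          ((erased n j (fun k => c (blockEquiv n (Sum.inr k)))).toNat : ℝ) -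
          ((erased n j (fun k => c (blockEquiv n (Sum.inl k)))).toNat : ℝ) *
          ((erased n j (fun k => c (blockEquiv n (Sum.inr k)))).toNat : ℝ) := fun c => by
        simp only [erased, Equiv.symm_apply_apply, Sum.elim_inl]
        cases erased n j fun k => c (blockEquiv n (Sum.inl k)) <;>
          cases erased n j fun k => c (blockEquiv n (Sum.inr k)) <;> simp
      simp only [h]
      rw [sum_bernoulliWeight_block n p fun c₁ c₂ => ((erased n j c₁).toNat : ℝ) +
        ((erased n j c₂).toNat : ℝ) - ((erased n j c₁).toNat : ℝ) * ((erased n j c₂).toNat : ℝ),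
        erasureProb_inl, ← ih j]
      set W := fun c : Fin (2 ^ n) → Bool => bernoulliWeight p c
      set E := fun c : Fin (2 ^ n) → Bool => bernoulliWeight p c * ((erased n j c).toNat : ℝ)
      calc _ = ∑ c₁, ∑ c₂, (E c₁ * W c₂ + W c₁ * E c₂ - E c₁ * E c₂) := by
            refine Finset.sum_congr rfl fun c₁ _ => Finset.sum_congr rfl fun c₂ _ => ?_
            simp only [E, W]
            ring
        _ = (∑ c, E c) * (∑ c, W c) + (∑ c, W c) * (∑ c, E c) - (∑ c, E c) * (∑ c, E c) := by
            simp only [Finset.sum_add_distrib, Finset.sum_sub_distrib, Finset.sum_mul_sum]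
        _ = _ := by
            rw [show ∑ c, W c = 1 from hsum]
            ring
    · have h : ∀ c, ((erased (n + 1) (blockEquiv n (Sum.inr j)) c).toNat : ℝ) =
          ((erased n j (fun k => c (blockEquiv n (Sum.inl k)))).toNat : ℝ) *
          ((erased n j (fun k => c (blockEquiv n (Sum.inr k)))).toNat : ℝ) := fun c => by
        simp only [erased, Equiv.symm_apply_apply, Sum.elim_inr]
        cases erased n j fun k => c (blockEquiv n (Sum.inl k)) <;>
          cases erased n j fun k => c (blockEquiv n (Sum.inr k)) <;> simp
      simp only [h]
      rw [sum_bernoulliWeight_block n p fun c₁ c₂ =>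
        ((erased n j c₁).toNat : ℝ) * ((erased n j c₂).toNat : ℝ),
        erasureProb_inr, ← ih j, sq, Finset.sum_mul_sum]
      refine Finset.sum_congr rfl fun c₁ _ => Finset.sum_congr rfl fun c₂ _ => ?_
      ring

lemma continuous_erasureProb (n : ℕ) (i : Fin (2 ^ n)) : Continuous (erasureProb n i) := by
  induction n with
  | zero => exact continuous_id
  | succ n ih =>
    obtain ⟨s, rfl⟩ := (blockEquiv n).surjective i
    rcases s with j | j
    · simp only [funext fun p => erasureProb_inl n j p]
      exact ((ih j).const_mul 2).sub ((ih j).pow 2)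
    · simp only [funext fun p => erasureProb_inr n j p]
      exact (ih j).pow 2

lemma erasureProb_mem (n : ℕ) (i : Fin (2 ^ n)) {p : ℝ} (h0 : 0 ≤ p) (h1 : p ≤ 1) :
    0 ≤ erasureProb n i p ∧ erasureProb n i p ≤ 1 := by
  induction n with
  | zero => exact ⟨h0, h1⟩
  | succ n ih =>
    obtain ⟨s, rfl⟩ := (blockEquiv n).surjective i
    rcases s with j | j
    · obtain ⟨ha, hb⟩ := ih j
      rw [erasureProb_inl]
      constructor <;> nlinarith
    · obtain ⟨ha, hb⟩ := ih j
      rw [erasureProb_inr]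
      constructor <;> nlinarith

lemma erasureProb_one (n : ℕ) (i : Fin (2 ^ n)) : erasureProb n i 1 = 1 := by
  induction n with
  | zero => rfl
  | succ n ih =>
    obtain ⟨s, rfl⟩ := (blockEquiv n).surjective i
    rcases s with j | j
    · rw [erasureProb_inl, ih]
      norm_num
    · rw [erasureProb_inr, ih, one_pow]

/-- The odds of the erasure probability relative to the odds of the parameter are monotone. -/
lemma erasureProb_odds (n : ℕ) (i : Fin (2 ^ n)) {p d : ℝ} (h0 : 0 ≤ p) (hpd : p ≤ d)
    (h1 : d ≤ 1) :
    erasureProb n i p ≤ erasureProb n i d ∧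
    erasureProb n i p * (1 - erasureProb n i d) * (d * (1 - p)) ≤
      p * (1 - d) * (erasureProb n i d * (1 - erasureProb n i p)) := by
  induction n with
  | zero => exact ⟨hpd, le_of_eq (rfl)⟩
  | succ n ih =>
    obtain ⟨s, rfl⟩ := (blockEquiv n).surjective i
    have hY : 0 ≤ p * (1 - d) := mul_nonneg h0 (by linarith)
    rcases s with j | j
    · obtain ⟨hab, h⟩ := ih j
      obtain ⟨ha0, ha1⟩ := erasureProb_mem n j h0 (hpd.trans h1)
      obtain ⟨hb0, hb1⟩ := erasureProb_mem n j (h0.trans hpd) h1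
      rw [erasureProb_inl, erasureProb_inl]
      set a := erasureProb n j p
      set b := erasureProb n j d
      refine ⟨by nlinarith, ?_⟩
      -- The odds of 2a - a² are those of a times (2 - a)/(1 - a), which increases with a.
      -- Everything is cross-multiplied so that the probabilities 0 and 1 are covered.
      have e1 := mul_le_mul_of_nonneg_left h
        (mul_nonneg (by linarith : 0 ≤ 2 - a) (by linarith : 0 ≤ 1 - b))
      have e2 : (2 - a) * (1 - b) ≤ (2 - b) * (1 - a) := by nlinarith
      have e3 := mul_le_mul_of_nonneg_left e2
        (mul_nonneg hY (mul_nonneg hb0 (by linarith : 0 ≤ 1 - a)))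
      nlinarith
    · obtain ⟨hab, h⟩ := ih j
      obtain ⟨ha0, ha1⟩ := erasureProb_mem n j h0 (hpd.trans h1)
      obtain ⟨hb0, hb1⟩ := erasureProb_mem n j (h0.trans hpd) h1
      rw [erasureProb_inr, erasureProb_inr]
      set a := erasureProb n j p
      set b := erasureProb n j d
      refine ⟨by nlinarith, ?_⟩
      -- The odds of a² are those of a times a/(1 + a), again increasing in a.
      have e1 := mul_le_mul_of_nonneg_left h (mul_nonneg ha0 (by linarith : 0 ≤ 1 + b))
      have e2 : a * (1 + b) ≤ b * (1 + a) := by nlinarith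
      have e3 := mul_le_mul_of_nonneg_left e2
        (mul_nonneg hY (mul_nonneg hb0 (by linarith : 0 ≤ 1 - a)))
      nlinarith

lemma sum_erasureProb (n : ℕ) (p : ℝ) : ∑ i, erasureProb n i p = 2 ^ n * p := by
  induction n with
  | zero =>
    have : ∑ i : Fin 1, erasureProb 0 i p = p := Fintype.sum_unique _
    simpa using this
  | succ n ih =>
    rw [sum_block, ← Finset.sum_add_distrib, pow_succ (2 : ℝ)]
    simp only [erasureProb_inl, erasureProb_inr, sub_add_cancel]
    rw [← Finset.mul_sum, ih]
    ring

/-- This is (2z - z²)² + z⁴ = 2z² + 2(z(1 - z))²: the mean square grows by the mean of (z(1 - z))².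
-/
lemma sum_erasureProb_sq_succ (n : ℕ) (p : ℝ) :
    ∑ i, erasureProb (n + 1) i p ^ 2 = 2 * ∑ i, erasureProb n i p ^ 2 +
      2 * ∑ i, (erasureProb n i p * (1 - erasureProb n i p)) ^ 2 := by
  rw [sum_block, ← Finset.sum_add_distrib, Finset.mul_sum, Finset.mul_sum,
    ← Finset.sum_add_distrib]
  refine Finset.sum_congr rfl fun j _ => ?_
  rw [erasureProb_inl, erasureProb_inr]
  ring

/-- The mean square V is increasing and bounded, so its increments U tend to 0; Cauchy-Schwarz
bounds the mean of z(1 - z) by √U. -/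
lemma tendsto_polarization {p : ℝ} (h0 : 0 ≤ p) (h1 : p ≤ 1) :
    Tendsto (fun n => (∑ i, erasureProb n i p * (1 - erasureProb n i p)) / 2 ^ n) atTop (𝓝 0) := by
  set V : ℕ → ℝ := fun n => (∑ i, erasureProb n i p ^ 2) / 2 ^ n with hV
  set U : ℕ → ℝ := fun n => (∑ i, (erasureProb n i p * (1 - erasureProb n i p)) ^ 2) / 2 ^ n
  have hstep : ∀ n, V (n + 1) = V n + U n := fun n => by
    simp only [V, U]
    rw [sum_erasureProb_sq_succ, pow_succ (2 : ℝ)]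
    field_simp
  have hU0 : ∀ n, 0 ≤ U n := fun n => by positivity
  have hmono : Monotone V := monotone_nat_of_le_succ fun n => by linarith [hstep n, hU0 n]
  have hbdd : ∀ n, V n ≤ 1 := fun n => by
    rw [hV, div_le_one (by positivity)]
    calc ∑ i, erasureProb n i p ^ 2 ≤ ∑ _i : Fin (2 ^ n), (1 : ℝ) :=
          Finset.sum_le_sum fun i _ => by
            obtain ⟨ha, hb⟩ := erasureProb_mem n i h0 h1
            nlinarith
      _ = 2 ^ n := by simp
  obtain ⟨v, hv⟩ : ∃ v, Tendsto V atTop (𝓝 v) :=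
    ⟨_, tendsto_atTop_ciSup hmono ⟨1, by rintro _ ⟨n, rfl⟩; exact hbdd n⟩⟩
  have hU : Tendsto U atTop (𝓝 0) := by
    have := ((tendsto_add_atTop_iff_nat 1).2 hv).sub hv
    rw [sub_self] at this
    exact this.congr fun n => by rw [hstep]; ring
  have hsqrt : Tendsto (fun n => √(U n)) atTop (𝓝 0) := by
    have := (Real.continuous_sqrt.tendsto 0).comp hU
    rwa [Real.sqrt_zero] at this
  refine squeeze_zero (fun n => div_nonneg (Finset.sum_nonneg fun i _ => ?_) (by positivity))
    (fun n => ?_) hsqrt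
  · obtain ⟨ha, hb⟩ := erasureProb_mem n i h0 h1
    exact mul_nonneg ha (by linarith)
  · refine Real.le_sqrt_of_sq_le ?_
    have := sq_sum_le_card_mul_sum_sq (s := Finset.univ)
      (f := fun i : Fin (2 ^ n) => erasureProb n i p * (1 - erasureProb n i p))
    simp only [Finset.card_univ, Fintype.card_fin, Nat.cast_pow, Nat.cast_ofNat] at this
    simp only [U]
    rw [div_pow, div_le_div_iff₀ (by positivity) (by positivity)]
    calc _ ≤ (2 ^ n * ∑ i, (erasureProb n i p * (1 - erasureProb n i p)) ^ 2) * 2 ^ n := by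
          gcongr
      _ = _ := by ring

/-- The mean of z is exactly d, and the indicator of z > η differs from z by at most (2 + 1/η) z(1 -
z), whose mean tends to 0. -/
lemma tendsto_card_erasureProb {d η : ℝ} (h0 : 0 ≤ d) (h1 : d ≤ 1) (hη : 0 < η) (hη' : η ≤ 1 / 2) :
    Tendsto (fun n => ((Finset.univ.filter fun i => η < erasureProb n i d).card : ℝ) / 2 ^ n)
      atTop (𝓝 d) := by
  rw [tendsto_iff_dist_tendsto_zero]
  have hlim := (tendsto_polarization h0 h1).const_mul (2 + 1 / η)
  rw [mul_zero] at hlim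
  refine squeeze_zero (fun _ => dist_nonneg) (fun n => ?_) hlim
  rw [Real.dist_eq]
  have hN : (0 : ℝ) < 2 ^ n := by positivity
  have : ((Finset.univ.filter fun i => η < erasureProb n i d).card : ℝ) / 2 ^ n - d =
      (∑ i, ((if η < erasureProb n i d then 1 else 0) - erasureProb n i d)) / 2 ^ n := by
    rw [Finset.sum_sub_distrib, sum_erasureProb, Finset.card_filter]
    push_cast
    field_simp
  rw [this, abs_div, abs_of_pos hN, ← mul_div_assoc, Finset.mul_sum]
  refine div_le_div_of_nonneg_right ((Finset.abs_sum_le_sum_abs _ _).trans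
    (Finset.sum_le_sum fun i _ => ?_)) hN.le
  obtain ⟨ha, hb⟩ := erasureProb_mem n i h0 h1
  set z := erasureProb n i d
  have hu : 0 ≤ z * (1 - z) := mul_nonneg ha (by linarith)
  split_ifs with h
  · rw [abs_of_nonneg (by linarith)]
    have : 1 - z ≤ 1 / η * (z * (1 - z)) := by
      rw [div_mul_eq_mul_div, one_mul, le_div_iff₀ hη]
      nlinarith
    linarith
  · rw [zero_sub, abs_neg, abs_of_nonneg ha]
    have h2 : z ≤ 2 * (z * (1 - z)) := by nlinarith
    have : 0 ≤ 1 / η * (z * (1 - z)) := by positivity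
    linarith

/-- A universal choice of rows: their rate is `d` and they are good for all `p ≤ d`. -/
lemma exists_rows {d ε : ℝ} (h0 : 0 ≤ d) (h1 : d ≤ 1) (hε : 0 < ε) :
    ∃ A : ∀ n, Finset (Fin (2 ^ n)),
      Tendsto (fun n => ((A n).card : ℝ) / 2 ^ n) atTop (𝓝 d) ∧
      ∀ n p, 0 < p → p ≤ d → ∑ i ∈ (A n)ᶜ, erasureProb n i p < ε * (2 ^ n * p) := by
  -- For d = 0 there is no admissible p, and any threshold will do.
  obtain ⟨η, hη, hη', hηd⟩ : ∃ η : ℝ, 0 < η ∧ η ≤ 1 / 2 ∧ (0 < d → 4 * η ≤ ε * d) := by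
    rcases h0.eq_or_lt with rfl | hd
    · exact ⟨1 / 2, by norm_num, le_rfl, fun h => absurd h (lt_irrefl _)⟩
    · refine ⟨min (1 / 2) (ε * d / 4), by positivity, min_le_left _ _, fun _ => ?_⟩
      linarith [min_le_right (1 / 2) (ε * d / 4)]
  refine ⟨fun n => Finset.univ.filter fun i => η < erasureProb n i d,
    tendsto_card_erasureProb h0 h1 hη hη', fun n p hp hpd => ?_⟩
  have hd : 0 < d := hp.trans_le hpd
  have hle : ∀ i ∈ (Finset.univ.filter fun i => η < erasureProb n i d)ᶜ,
      erasureProb n i p ≤ ε / 2 * p := fun i hi => by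
    have hi' : erasureProb n i d ≤ η := by simpa using hi
    obtain ⟨ha, hb⟩ := erasureProb_mem n i hp.le (hpd.trans h1)
    obtain ⟨ha', hb'⟩ := erasureProb_mem n i h0 h1
    -- For d = 1 all erasure probabilities are 1 and no row is discarded. Strictness gives p < 1,
    -- which allows 1 - p to be cancelled below.
    have hd1 : d < 1 := lt_of_le_of_ne h1 fun h => by
      rw [h, erasureProb_one] at hi'
      linarith
    have h := (erasureProb_odds n i hp.le hpd h1).2
    set a := erasureProb n i p
    set b := erasureProb n i d
    have e1 : p * (1 - d) * (b * (1 - a)) ≤ (p * b) * (1 - p) := by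
      have : (1 - d) * (1 - a) ≤ 1 - p := by nlinarith
      nlinarith [mul_le_mul_of_nonneg_left this (mul_nonneg hp.le ha')]
    have e2 : (a * (1 - b) * d) * (1 - p) ≤ (p * b) * (1 - p) := by linarith
    -- With b ≤ η ≤ 1/2 this yields a d ≤ 2 p η ≤ (ε/2) p d. The bound is proportional to p, and the
    -- spare factor 1/2 makes the final inequality strict.
    have e3 : a * (1 - b) * d ≤ p * b := le_of_mul_le_mul_right e2 (by linarith)
    have e4 : a * (1 / 2) * d ≤ a * (1 - b) * d := by gcongr; linarith
    have e5 : p * b ≤ p * η := by gcongr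
    have e6 : p * (4 * η) ≤ p * (ε * d) := mul_le_mul_of_nonneg_left (hηd hd) hp.le
    have e7 : a * d ≤ (ε / 2 * p) * d := by linarith
    exact le_of_mul_le_mul_right e7 hd
  calc _ ≤ ∑ i ∈ (Finset.univ.filter fun i => η < erasureProb n i d)ᶜ, ε / 2 * p :=
        Finset.sum_le_sum hle
    _ ≤ ∑ _i : Fin (2 ^ n), ε / 2 * p :=
        Finset.sum_le_univ_sum_of_nonneg fun _ => by positivity
    _ = ε / 2 * (2 ^ n * p) := by simp; ring
    _ < _ := by
        have : 0 < ε * (2 ^ n * p) := by positivity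
        linarith

/-! ### Stable recovery and the code for the quantized vector -/

/-- Stable linear recovery of a vector from linear measurements and some of its coordinates. -/
lemma exists_stable_recovery {m N : ℕ} (Φ : Matrix (Fin m) (Fin N) ℝ) (K : Fin N → Prop)
    (hK : ∀ x : Fin N → ℝ, Φ.mulVec x = 0 → (∀ i, K i → x i = 0) → x = 0) :
    ∃ (G : (Fin m → ℝ) → (Fin N → ℝ) → Fin N → ℝ) (B : ℝ), 0 ≤ B ∧
      (∀ v, Measurable fun y => G y v) ∧
      ∀ (x v : Fin N → ℝ) (ε : ℝ), 0 ≤ ε → (∀ i, K i → |x i - v i| ≤ ε) →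
        (∀ i, ¬ K i → v i = 0) → ∀ i, |x i - G (Φ.mulVec x) v i| ≤ B * ε := by
  classical
  let mask : (Fin N → ℝ) →ₗ[ℝ] (Fin N → ℝ) :=
    LinearMap.pi fun i => if K i then LinearMap.proj i else 0
  have hmask : ∀ x i, mask x i = if K i then x i else 0 := fun x i => by
    simp only [mask, LinearMap.pi_apply]
    split_ifs <;> simp
  -- Measurements and known coordinates together determine x, so T has a linear left inverse; its
  -- operator norm serves as B.
  let T : (Fin N → ℝ) →ₗ[ℝ] (Fin m → ℝ) × (Fin N → ℝ) := Φ.mulVecLin.prod mask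
  have hT : LinearMap.ker T = ⊥ := by
    rw [LinearMap.ker_eq_bot']
    intro x hx
    have hx' := Prod.ext_iff.1 hx
    refine hK x hx'.1 fun i hi => ?_
    have := congrFun hx'.2 i
    simpa [T, hmask, hi] using this
  obtain ⟨G, hG⟩ := LinearMap.exists_leftInverse_of_injective T hT
  let Gc := LinearMap.toContinuousLinearMap G
  refine ⟨fun y v => G (y, v), ‖Gc‖, norm_nonneg _, fun v => ?_, fun x v ε hε h1 h2 i => ?_⟩
  · exact (Gc.continuous.comp (by fun_prop : Continuous fun y : Fin m → ℝ => (y, v))).measurable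
  · have h3 : x = G (Φ.mulVec x, mask x) := (LinearMap.congr_fun hG x).symm
    have h4 : x - G (Φ.mulVec x, v) = Gc (0, mask x - v) := by
      nth_rewrite 1 [h3]
      rw [← map_sub]
      simp [Gc]
    have h5 : ‖((0 : Fin m → ℝ), mask x - v)‖ ≤ ε := by
      rw [Prod.norm_def, norm_zero]
      refine max_le hε ((pi_norm_le_iff_of_nonneg hε).2 fun j => ?_)
      change ‖(mask x - v) j‖ ≤ ε
      rw [Pi.sub_apply, hmask, Real.norm_eq_abs]
      split_ifs with hj
      · exact h1 j hj
      · simpa [h2 j hj] using hε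
    calc |x i - G (Φ.mulVec x, v) i| = ‖(x - G (Φ.mulVec x, v)) i‖ := rfl
      _ ≤ ‖x - G (Φ.mulVec x, v)‖ := norm_le_pi_norm _ i
      _ ≤ ‖Gc‖ * ε := by
        rw [h4]
        exact (Gc.le_opNorm _).trans (by gcongr)

lemma tsum_prod_mul {α β : Type*} (f : α → ℝ≥0∞) (g : β → ℝ≥0∞) :
    ∑' k : α × β, f k.1 * g k.2 = (∑' a, f a) * ∑' b, g b := by
  rw [ENNReal.tsum_prod', ← ENNReal.tsum_mul_right]
  refine tsum_congr fun a => ?_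
  change ∑' b, f a * g b = _
  exact ENNReal.tsum_mul_left

lemma tsum_pi_prod {κ : Type*} (f : κ → ℝ≥0∞) (N : ℕ) :
    ∑' k : Fin N → κ, ∏ i, f (k i) = (∑' a, f a) ^ N := by
  induction N with
  | zero => simp [tsum_fintype]
  | succ N ih =>
    rw [← Equiv.tsum_eq (Fin.consEquiv fun _ => κ), ENNReal.tsum_prod', pow_succ', ← ih,
      ← ENNReal.tsum_mul_right]
    refine tsum_congr fun a => ?_
    rw [← ENNReal.tsum_mul_left]
    refine tsum_congr fun k => ?_
    simp [Fin.consEquiv, Fin.prod_univ_succ]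

lemma tsum_two_pow_natAbs_ne_top :
    ∑' t : ℤ, ENNReal.ofReal ((1 / 2 : ℝ) ^ t.natAbs) ≠ ⊤ := by
  refine Summable.tsum_ofReal_ne_top (Summable.of_nat_of_neg ?_ ?_)
  · simpa using summable_geometric_two
  · simpa using summable_geometric_two

/-- The codeword of one coordinate: the value if it is one of the atoms in `F`, the integer part,
the cell of the fractional part, and a correction of the quantized reconstruction. -/
abbrev CoordCode (F : Finset ℝ) (q : ℕ) : Type := (Option F × ℤ × Fin q) × ℤ

/-- The weight of a codeword. -/
noncomputable def codeWeight {F : Finset ℝ} {q : ℕ} (k : CoordCode F q) : ℝ :=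
  (1 / 2) ^ k.1.2.1.natAbs * (if (k.1.2.2 : ℕ) = 0 then 1 else 1 / (q : ℝ)) * (1 / 2) ^ k.2.natAbs

lemma codeWeight_pos {F : Finset ℝ} {q : ℕ} (hq : 0 < q) (k : CoordCode F q) :
    0 < codeWeight k := by
  unfold codeWeight
  have : (0 : ℝ) < q := Nat.cast_pos.2 hq
  split_ifs <;> positivity

lemma neg_logb_codeWeight {F : Finset ℝ} {q : ℕ} (hq : 0 < q) (k : CoordCode F q) :
    -Real.logb 2 (codeWeight k) =
      k.1.2.1.natAbs + (if (k.1.2.2 : ℕ) = 0 then 0 else Real.logb 2 q) + k.2.natAbs := by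
  have hq' : (q : ℝ) ≠ 0 := Nat.cast_ne_zero.2 hq.ne'
  have hp : ∀ n : ℕ, Real.logb 2 ((1 / 2 : ℝ) ^ n) = -n := fun n => by
    rw [Real.logb_pow, one_div, Real.logb_inv, Real.logb_self_eq_one one_lt_two]
    ring
  have hu : (if (k.1.2.2 : ℕ) = 0 then 1 else 1 / (q : ℝ)) ≠ 0 := by
    split_ifs <;> simp [hq']
  rw [codeWeight, Real.logb_mul (by positivity) (by positivity), Real.logb_mul (by positivity) hu,
    hp, hp]
  split_ifs
  · simp
    ring
  · rw [one_div, Real.logb_inv]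
    ring

/-- The bound does not depend on q: the cell weights sum to 1 + (q - 1)/q ≤ 2. Cell 0 thus costs no
bits, which makes coordinates without a transmitted cell free of the log₂ q term. -/
lemma tsum_codeWeight_le (F : Finset ℝ) {q : ℕ} (hq : 0 < q) :
    ∑' k : CoordCode F q, ENNReal.ofReal (codeWeight k) ≤
      ((F.card + 1 : ℕ) * ((∑' t : ℤ, ENNReal.ofReal ((1 / 2 : ℝ) ^ t.natAbs)) * 2)) *
        ∑' t : ℤ, ENNReal.ofReal ((1 / 2 : ℝ) ^ t.natAbs) := by
  have hq' : (0 : ℝ) < q := Nat.cast_pos.2 hq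
  have hu : ∀ r : Fin q, 0 ≤ (if (r : ℕ) = 0 then 1 else 1 / (q : ℝ)) := fun r => by
    split_ifs <;> positivity
  have husum : ∑' r : Fin q, ENNReal.ofReal (if (r : ℕ) = 0 then 1 else 1 / (q : ℝ)) ≤ 2 := by
    rw [tsum_fintype, ← ENNReal.ofReal_sum_of_nonneg fun r _ => hu r]
    refine ENNReal.ofReal_le_of_le_toReal ?_
    calc ∑ r : Fin q, (if (r : ℕ) = 0 then 1 else 1 / (q : ℝ))
        ≤ ∑ r : Fin q, ((if r = ⟨0, hq⟩ then 1 else 0) + 1 / (q : ℝ)) := by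
          refine Finset.sum_le_sum fun r _ => ?_
          simp only [Fin.ext_iff]
          have : 0 ≤ 1 / (q : ℝ) := by positivity
          split_ifs <;> linarith
      _ = 2 := by
          rw [Finset.sum_add_distrib, Finset.sum_ite_eq' Finset.univ (⟨0, hq⟩ : Fin q)]
          simp [hq.ne']
          norm_num
      _ = _ := by simp
  have hmul : ∀ k : CoordCode F q, ENNReal.ofReal (codeWeight k) =
      (ENNReal.ofReal ((1 / 2 : ℝ) ^ k.1.2.1.natAbs) *
        ENNReal.ofReal (if (k.1.2.2 : ℕ) = 0 then 1 else 1 / (q : ℝ))) *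
        ENNReal.ofReal ((1 / 2 : ℝ) ^ k.2.natAbs) := fun k => by
    rw [codeWeight, ENNReal.ofReal_mul (mul_nonneg (by positivity) (hu _)),
      ENNReal.ofReal_mul (by positivity)]
  simp only [hmul]
  rw [tsum_prod_mul (fun k : Option F × ℤ × Fin q => ENNReal.ofReal ((1 / 2 : ℝ) ^ k.2.1.natAbs) *
    ENNReal.ofReal (if (k.2.2 : ℕ) = 0 then 1 else 1 / (q : ℝ)))
    fun t : ℤ => ENNReal.ofReal ((1 / 2 : ℝ) ^ t.natAbs)]
  refine mul_le_mul_left ?_ _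
  rw [ENNReal.tsum_prod', tsum_fintype]
  change ∑ _a : Option F, ∑' r : ℤ × Fin q, ENNReal.ofReal ((1 / 2 : ℝ) ^ r.1.natAbs) *
    ENNReal.ofReal (if (r.2 : ℕ) = 0 then 1 else 1 / (q : ℝ)) ≤ _
  rw [Finset.sum_const, Finset.card_univ, Fintype.card_option, Fintype.card_coe,
    nsmul_eq_mul]
  refine mul_le_mul_right ?_ _
  rw [tsum_prod_mul (fun t : ℤ => ENNReal.ofReal ((1 / 2 : ℝ) ^ t.natAbs))
    fun r : Fin q => ENNReal.ofReal (if (r : ℕ) = 0 then 1 else 1 / (q : ℝ))]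
  exact mul_le_mul_right husum _

/-- Which coordinates of a vector lie outside the finite set `F`. -/
noncomputable def offPattern (F : Finset ℝ) {N : ℕ} (x : Fin N → ℝ) : Fin N → Bool :=
  fun i => open Classical in decide (x i ∉ F)

lemma measurable_decide_notMem (F : Finset ℝ) :
    Measurable fun a : ℝ => open Classical in decide (a ∉ F) := by
  classical
  refine measurable_to_bool ?_
  convert F.measurableSet.compl using 1
  ext a
  simp

lemma measure_offPattern (F : Finset ℝ) (π : Measure ℝ) [IsProbabilityMeasure π] (N : ℕ)
    (c : Fin N → Bool) : (iidLaw π N).map (offPattern F) {c} =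
      ENNReal.ofReal (bernoulliWeight (π.real (F : Set ℝ)ᶜ) c) := by
  classical
  have hm := measurable_decide_notMem F
  have : IsProbabilityMeasure (π.map fun a : ℝ => decide (a ∉ F)) :=
    Measure.isProbabilityMeasure_map hm.aemeasurable
  have h : (iidLaw π N).map (offPattern F) =
      Measure.pi fun _ => π.map fun a : ℝ => decide (a ∉ F) :=
    Measure.pi_map_pi (μ := fun _ : Fin N => π) (f := fun _ a => decide (a ∉ F))
      fun _ => hm.aemeasurable
  rw [h, Measure.pi_singleton, bernoulliWeight, ENNReal.ofReal_prod_of_nonneg]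
  · refine Finset.prod_congr rfl fun i _ => ?_
    rw [Measure.map_apply hm (measurableSet_singleton _)]
    cases c i
    · have e : (fun a : ℝ => decide (a ∉ F)) ⁻¹' {false} = (F : Set ℝ) := by
        ext a
        simp
      rw [e, probReal_compl_eq_one_sub F.measurableSet]
      simp
    · have e : (fun a : ℝ => decide (a ∉ F)) ⁻¹' {true} = (F : Set ℝ)ᶜ := by
        ext a
        simp
      rw [e]
      simp
  · intro i _
    split_ifs
    · exact measureReal_nonneg
    · exact sub_nonneg.2 measureReal_le_one

lemma measurable_offPattern (F : Finset ℝ) (N : ℕ) : Measurable (offPattern F (N := N)) :=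
  measurable_pi_lambda _ fun i => (measurable_decide_notMem F).comp (measurable_pi_apply i)

lemma lintegral_offPattern (F : Finset ℝ) (π : Measure ℝ) [IsProbabilityMeasure π] (N : ℕ)
    {g : (Fin N → Bool) → ℝ} (hg : ∀ c, 0 ≤ g c) :
    ∫⁻ x, ENNReal.ofReal (g (offPattern F x)) ∂(iidLaw π N) =
      ENNReal.ofReal (∑ c, bernoulliWeight (π.real (F : Set ℝ)ᶜ) c * g c) := by
  have hw := fun c : Fin N → Bool => bernoulliWeight_nonneg
    (p := π.real (F : Set ℝ)ᶜ) measureReal_nonneg measureReal_le_one c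
  rw [← lintegral_map (f := fun c => ENNReal.ofReal (g c)) (measurable_of_finite _)
    (measurable_offPattern F N), lintegral_fintype,
    ENNReal.ofReal_sum_of_nonneg fun c _ => mul_nonneg (hw c) (hg c)]
  refine Finset.sum_congr rfl fun c _ => ?_
  rw [measure_offPattern, ENNReal.ofReal_mul (hw c), mul_comm]

/-- The vector known to the decoder: the atoms, and the coordinates in `J` up to `1 / q`. -/
noncomputable def codeVal {F : Finset ℝ} {q N : ℕ} (J : (Fin N → Bool) → Finset (Fin N))
    (k : Fin N → Option F × ℤ × Fin q) (i : Fin N) : ℝ :=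
  (k i).1.elim (if i ∈ J fun j => (k j).1.isNone then (k i).2.1 + ((k i).2.2 : ℕ) / (q : ℝ) else 0)
    fun a => a

/-- The encoder without the correction. The atoms in the codeword reveal the pattern, hence also J,
to the decoder; coordinates outside J transmit cell 0, and unknown ones get the value 0 that
`exists_stable_recovery` expects. -/
lemma exists_preCode (F : Finset ℝ) {q N : ℕ} (hq : 0 < q)
    (J : (Fin N → Bool) → Finset (Fin N)) (x : Fin N → ℝ) :
    ∃ k : Fin N → Option F × ℤ × Fin q, (fun i => (k i).1.isNone) = offPattern F x ∧
      (∀ i, (k i).2.1 = ⌊x i⌋) ∧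
      (∀ i, i ∉ J (offPattern F x) → ((k i).2.2 : ℕ) = 0) ∧
      (∀ i, offPattern F x i = false ∨ i ∈ J (offPattern F x) →
        |x i - codeVal J k i| ≤ 1 / q) ∧
      ∀ i, ¬ (offPattern F x i = false ∨ i ∈ J (offPattern F x)) → codeVal J k i = 0 := by
  classical
  have hq' : (0 : ℝ) < q := Nat.cast_pos.2 hq
  have hfl : ∀ a : ℝ, ⌊(q : ℝ) * Int.fract a⌋₊ < q := fun a => by
    rw [Nat.floor_lt (mul_nonneg hq'.le (Int.fract_nonneg a))]
    nlinarith [Int.fract_lt_one a]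
  let k : Fin N → Option F × ℤ × Fin q := fun i =>
    (if h : x i ∈ F then some ⟨x i, h⟩ else none, ⌊x i⌋,
      if i ∈ J (offPattern F x) then ⟨⌊(q : ℝ) * Int.fract (x i)⌋₊, hfl _⟩ else ⟨0, hq⟩)
  have hk : (fun i => (k i).1.isNone) = offPattern F x := by
    ext i
    simp only [k, offPattern]
    split_ifs with h <;> simp [h]
  refine ⟨k, hk, fun i => rfl, fun i hi => by simp [k, hi], fun i hi => ?_, fun i hi => ?_⟩
  · rw [codeVal, hk]
    by_cases h : x i ∈ F
    · simp [k, h]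
    · have hJ : i ∈ J (offPattern F x) := hi.resolve_left (by simp [offPattern, h])
      simp only [k, h, hJ, dite_false, if_true, Option.elim_none]
      have h1 := Nat.floor_le (mul_nonneg hq'.le (Int.fract_nonneg (x i)))
      have h2 := Nat.lt_floor_add_one ((q : ℝ) * Int.fract (x i))
      have h3 : x i - (⌊x i⌋ + (⌊(q : ℝ) * Int.fract (x i)⌋₊ : ℝ) / q) =
          ((q : ℝ) * Int.fract (x i) - ⌊(q : ℝ) * Int.fract (x i)⌋₊) / q := by
        rw [← Int.self_sub_floor]
        field_simp
        ring
      rw [h3, abs_of_nonneg (div_nonneg (by linarith) hq'.le)]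
      gcongr
      linarith
  · rw [codeVal, hk]
    push Not at hi
    have h : x i ∉ F := by
      by_contra h
      exact hi.1 (by simp [offPattern, h])
    simp [k, h, hi.2]

lemma natAbs_floor_le (a : ℝ) : (⌊a⌋.natAbs : ℝ) ≤ |a| + 1 := by
  rw [Nat.cast_natAbs, Int.cast_abs]
  have h1 := Int.floor_le a
  have h2 := Int.lt_floor_add_one a
  rw [abs_le]
  constructor <;> cases abs_cases a <;> linarith

lemma natAbs_floor_sub_floor_le {a b B : ℝ} (h : |a - b| ≤ B) :
    ((⌊a⌋ - ⌊b⌋).natAbs : ℝ) ≤ B + 1 := by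
  rw [Nat.cast_natAbs, Int.cast_abs, Int.cast_sub]
  have h1 := Int.floor_le a
  have h2 := Int.lt_floor_add_one a
  have h3 := Int.floor_le b
  have h4 := Int.lt_floor_add_one b
  rw [abs_le] at h ⊢
  constructor <;> linarith

/-- If the known coordinates and those in `J` determine the vector together with `Φ x`, then the
conditional entropy is at most the mean number of coordinates in `J` times `log₂ q`, up to a
constant. -/
theorem condEntropy_le_of_recovery_set {m N : ℕ} (Φ : Matrix (Fin m) (Fin N) ℝ) (π : Measure ℝ)
    [IsProbabilityMeasure π] (hπ : Integrable (fun x : ℝ => x) π) (F : Finset ℝ)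
    (J : (Fin N → Bool) → Finset (Fin N))
    (hJ : ∀ c, ∀ x : Fin N → ℝ, Φ.mulVec x = 0 → (∀ i, c i = false ∨ i ∈ J c → x i = 0) → x = 0) :
    ∃ K : ℝ, 0 ≤ K ∧ ∀ q : ℕ, 0 < q →
      condEntropy (quantizeVec q) (fun x => Φ.mulVec x) (iidLaw π N) ≤ ENNReal.ofReal
        (K + Real.logb 2 q * ∑ c, bernoulliWeight (π.real (F : Set ℝ)ᶜ) c * (J c).card) := by
  choose G B' hB' hGm hG using fun c => exists_stable_recovery Φ _ (hJ c)
  -- There are finitely many patterns, so one stability constant serves them all.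
  obtain ⟨B, hB0, hB⟩ : ∃ B : ℝ, 0 ≤ B ∧ ∀ c, B' c ≤ B :=
    ⟨∑ c, B' c, Finset.sum_nonneg fun c _ => hB' c,
      fun c => Finset.single_le_sum (f := B') (fun c _ => hB' c) (Finset.mem_univ c)⟩
  set T := ∑' t : ℤ, ENNReal.ofReal ((1 / 2 : ℝ) ^ t.natAbs)
  have hT : T ≠ ⊤ := tsum_two_pow_natAbs_ne_top
  set S : ℝ≥0∞ := (((F.card + 1 : ℕ) * (T * 2)) * T) ^ N
  have hS : S ≠ ⊤ := ENNReal.pow_ne_top (ENNReal.mul_ne_top (ENNReal.mul_ne_top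
    (ENNReal.natCast_ne_top _) (ENNReal.mul_ne_top hT (by simp))) hT)
  set K : ℝ≥0∞ := ∫⁻ x, ENNReal.ofReal (∑ i : Fin N, (|x i| + (B + 2))) ∂(iidLaw π N) +
    S * ENNReal.ofReal (1 / Real.log 2)
  have hK : K ≠ ⊤ := by
    refine ENNReal.add_ne_top.2 ⟨?_, ENNReal.mul_ne_top hS ENNReal.ofReal_ne_top⟩
    have hint : Integrable (fun x : Fin N → ℝ => ∑ i : Fin N, (|x i| + (B + 2))) (iidLaw π N) := by
      refine integrable_finsetSum _ fun i _ => Integrable.add ?_ (integrable_const _)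
      exact ((measurePreserving_eval (fun _ : Fin N => π) i).integrable_comp
        hπ.abs.aestronglyMeasurable).2 hπ.abs
    exact hint.lintegral_lt_top.ne
  refine ⟨K.toReal, ENNReal.toReal_nonneg, fun q hq => ?_⟩
  have hq' : (0 : ℝ) < q := Nat.cast_pos.2 hq
  have hlog : 0 ≤ Real.logb 2 q := Real.logb_nonneg one_lt_two (Nat.one_le_cast.2 hq)
  choose k hkpat hkt hkr hkv hkz using fun x : Fin N → ℝ => exists_preCode F hq J x
  -- The decoder quantizes the linear reconstruction and adds the transmitted integer, so the
  -- quantized vector is recovered exactly.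
  let dec : (Fin m → ℝ) → (Fin N → CoordCode F q) → Fin N → ℝ := fun y e i =>
    ((⌊(q : ℝ) * G (fun j => (e j).1.1.isNone) y (codeVal J fun j => (e j).1) i⌋ + (e i).2 : ℤ) : ℝ)
      / q
  let enc : (Fin N → ℝ) → Fin N → CoordCode F q := fun x i =>
    (k x i, ⌊(q : ℝ) * x i⌋ - ⌊(q : ℝ) * G (offPattern F x) (Φ.mulVec x) (codeVal J (k x)) i⌋)
  have hwpos : ∀ e : Fin N → CoordCode F q, 0 < ∏ i, codeWeight (e i) := fun e =>
    Finset.prod_pos fun i _ => codeWeight_pos hq _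
  have hwS : ∑' e : Fin N → CoordCode F q, ENNReal.ofReal (∏ i, codeWeight (e i)) ≤ S := by
    simp only [ENNReal.ofReal_prod_of_nonneg fun i _ => (codeWeight_pos hq _).le]
    rw [tsum_pi_prod fun a : CoordCode F q => ENNReal.ofReal (codeWeight a)]
    exact pow_le_pow_left' (tsum_codeWeight_le F hq) N
  have hdec : ∀ e, Measurable fun y => dec y e := fun e => by
    refine measurable_pi_lambda _ fun i => Measurable.div_const ?_ _
    refine (measurable_from_top (f := fun n : ℤ => ((n + (e i).2 : ℤ) : ℝ))).comp
      (Int.measurable_floor.comp ((measurable_pi_apply i).comp (hGm _ _) |>.const_mul _))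
  have henc : ∀ x, quantizeVec q x = dec (Φ.mulVec x) (enc x) := fun x => by
    ext i
    simp only [dec, enc, hkpat x]
    rw [add_sub_cancel]
    rfl
  have hlen : ∀ x, -Real.logb 2 (∏ i, codeWeight (enc x i)) ≤
      ∑ i, (|x i| + (B + 2)) + Real.logb 2 q * (J (offPattern F x)).card := fun x => by
    have hcard : Real.logb 2 q * (J (offPattern F x)).card =
        ∑ i, if i ∈ J (offPattern F x) then Real.logb 2 q else 0 := by
      rw [Finset.sum_ite_mem, Finset.univ_inter, Finset.sum_const, nsmul_eq_mul, mul_comm]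
    rw [Real.logb_prod _ _ fun i _ => (codeWeight_pos hq _).ne', ← Finset.sum_neg_distrib, hcard,
      ← Finset.sum_add_distrib]
    refine Finset.sum_le_sum fun i _ => ?_
    rw [neg_logb_codeWeight hq]
    have h1 : (((enc x i).1.2.1).natAbs : ℝ) ≤ |x i| + 1 := by
      simp only [enc, hkt]
      exact natAbs_floor_le _
    have h2 : (if ((enc x i).1.2.2 : ℕ) = 0 then 0 else Real.logb 2 q) ≤
        if i ∈ J (offPattern F x) then Real.logb 2 q else 0 := by
      by_cases hi : i ∈ J (offPattern F x)
      · rw [if_pos hi]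
        split_ifs <;> simp [hlog]
      · rw [if_neg hi, if_pos (hkr x i hi)]
    -- The reconstruction error is at most B/q, that is, B cells: the correction has bounded length
    -- uniformly in q.
    have h3 : ((enc x i).2.natAbs : ℝ) ≤ B + 1 := by
      refine natAbs_floor_sub_floor_le ?_
      have := hG (offPattern F x) x (codeVal J (k x)) (1 / q) (by positivity) (hkv x) (hkz x) i
      rw [← mul_sub, abs_mul, abs_of_pos hq']
      calc _ ≤ (q : ℝ) * (B' (offPattern F x) * (1 / q)) := by gcongr
        _ = B' (offPattern F x) := by field_simp
        _ ≤ B := hB _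
    linarith
  have hJ0 : ∀ c : Fin N → Bool, 0 ≤ Real.logb 2 q * ((J c).card : ℝ) := fun c => by positivity
  calc condEntropy (quantizeVec q) (fun x => Φ.mulVec x) (iidLaw π N)
      ≤ ∫⁻ x, ENNReal.ofReal (-Real.logb 2 (∏ i, codeWeight (enc x i))) ∂(iidLaw π N) +
          S * ENNReal.ofReal (1 / Real.log 2) :=
        condEntropy_le_of_code (measurable_quantizeVec q)
          (Continuous.measurable (Continuous.matrix_mulVec continuous_const continuous_id))
          (fun e : Fin N → CoordCode F q => ∏ i, codeWeight (e i)) hwpos hS hwS dec hdec enc henc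
    _ ≤ ∫⁻ x, (ENNReal.ofReal (∑ i : Fin N, (|x i| + (B + 2))) +
          ENNReal.ofReal (Real.logb 2 q * (J (offPattern F x)).card)) ∂(iidLaw π N) +
          S * ENNReal.ofReal (1 / Real.log 2) := by
        gcongr with x
        exact (ENNReal.ofReal_le_ofReal (hlen x)).trans ENNReal.ofReal_add_le
    _ = K + ENNReal.ofReal
          (∑ c, bernoulliWeight (π.real (F : Set ℝ)ᶜ) c * (Real.logb 2 q * (J c).card)) := by
        rw [lintegral_add_left (by fun_prop), lintegral_offPattern F π N hJ0]
        simp only [K]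
        ring
    _ = _ := by
        have hnn : 0 ≤ ∑ c, bernoulliWeight (π.real (F : Set ℝ)ᶜ) c * ((J c).card : ℝ) :=
          Finset.sum_nonneg fun c _ => mul_nonneg
            (bernoulliWeight_nonneg measureReal_nonneg measureReal_le_one c) (Nat.cast_nonneg _)
        rw [ENNReal.ofReal_add ENNReal.toReal_nonneg (mul_nonneg hlog hnn), ENNReal.ofReal_toReal hK,
          Finset.mul_sum]
        congr 3
        ext c
        ring

/-! ### Entropy of one coordinate and the information dimension -/

/-- Here P is the mass of a cell, m the part of it with bounded density, and t ≥ m a uniform bound.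
Gibbs' inequality compares m with P, so a cell that also carries an atom loses only P / ln 2, and
these losses sum to a constant. -/
lemma mul_logb_le_of_le {m P t : ℝ} (hm : 0 ≤ m) (hmP : m ≤ P) (hP : P ≤ 1)
    (hmt : m ≤ t) : m * Real.logb 2 t⁻¹ ≤ -(P * Real.logb 2 P) + P / Real.log 2 := by
  have h2 : 0 < Real.log 2 := Real.log_pos one_lt_two
  have hP0 : 0 ≤ P := hm.trans hmP
  have hlP : 0 ≤ -Real.logb 2 P := neg_nonneg.2 (Real.logb_nonpos one_lt_two hP0 hP)
  rcases hm.eq_or_lt with rfl | hm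
  · have : 0 ≤ P / Real.log 2 := by positivity
    nlinarith
  · have h1 := neg_mul_logb_le hm.le (hm.trans_le hmP)
    have h3 : m * Real.logb 2 m ≤ m * Real.logb 2 t :=
      mul_le_mul_of_nonneg_left (Real.logb_le_logb_of_le one_lt_two hm hmt) hm.le
    have h4 : m * -Real.logb 2 P ≤ P * -Real.logb 2 P := mul_le_mul_of_nonneg_right hmP hlP
    rw [Real.logb_inv]
    linarith

lemma volume_quantize_preimage_le {q : ℕ} (hq : 0 < q) (a : ℝ) :
    volume (quantize q ⁻¹' {a}) ≤ ENNReal.ofReal (1 / q) := by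
  have hq' : (0 : ℝ) < q := Nat.cast_pos.2 hq
  have hsub : quantize q ⁻¹' {a} ⊆ Set.Icc a (a + 1 / q) := by
    rintro x hx
    have hx' : (⌊(q : ℝ) * x⌋ : ℝ) / q = a := hx
    have h1 := Int.floor_le ((q : ℝ) * x)
    have h2 := Int.lt_floor_add_one ((q : ℝ) * x)
    rw [← hx', ← add_div]
    exact ⟨(div_le_iff₀ hq').2 (by linarith), (le_div_iff₀ hq').2 (by linarith)⟩
  refine (measure_mono hsub).trans ?_
  rw [Real.volume_Icc]
  simp

/-- The density is finite almost everywhere, so its sublevel sets exhaust the law. -/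
lemma exists_density_bound (pc : Measure ℝ) [IsProbabilityMeasure pc] (hpc : pc ≪ volume)
    {t : ℝ≥0∞} (ht : t < 1) :
    ∃ (M : ℕ) (B : Set ℝ), MeasurableSet B ∧ t < pc B ∧ ∀ s, pc (s ∩ B) ≤ M * volume s := by
  set f := pc.rnDeriv volume
  have hf : Measurable f := Measure.measurable_rnDeriv _ _
  let B : ℕ → Set ℝ := fun M => {x | f x ≤ M}
  have hB : ∀ M, MeasurableSet (B M) := fun M => measurableSet_le hf measurable_const
  have hmono : Monotone B := fun M M' h x (hx : f x ≤ M) =>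
    show f x ≤ M' from hx.trans (Nat.cast_le.2 h)
  have hU : pc (⋃ M, B M) = 1 := by
    rw [prob_compl_eq_zero_iff (MeasurableSet.iUnion hB) |>.symm]
    refine measure_mono_null ?_ (hpc (ae_iff.1 (Measure.rnDeriv_lt_top pc volume)))
    intro x hx hlt
    obtain ⟨M, hM⟩ := ENNReal.exists_nat_gt hlt.ne
    exact hx (Set.mem_iUnion.2 ⟨M, hM.le⟩)
  have hlim := tendsto_measure_iUnion_atTop (μ := pc) hmono
  rw [hU] at hlim
  obtain ⟨M, hM⟩ := (hlim.eventually (lt_mem_nhds ht)).exists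
  refine ⟨M, B M, hB M, hM, fun s => ?_⟩
  calc pc (s ∩ B M) = volume.withDensity f (s ∩ B M) := by
        rw [Measure.withDensity_rnDeriv_eq _ _ hpc]
    _ = ∫⁻ x in s ∩ B M, f x := withDensity_apply' _ _
    _ = ∫⁻ x in s, f x ∂(volume.restrict (B M)) := by
        rw [Measure.restrict_restrict' (hB M)]
    _ ≤ ∫⁻ x in s, (M : ℝ≥0∞) ∂(volume.restrict (B M)) := by
        refine lintegral_mono_ae (ae_restrict_of_ae ?_)
        filter_upwards [ae_restrict_mem (hB M)] with x hx using hx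
    _ ≤ M * volume s := by
        rw [setLIntegral_const]
        gcongr
        exact Measure.restrict_le_self

/-- A law that dominates `δ` times an absolutely continuous law has quantized entropy at least
`λ log₂ q` for every `λ < δ`, up to a constant. -/
lemma entropy_quantize_ge (π pc : Measure ℝ) [IsProbabilityMeasure π] [IsProbabilityMeasure pc]
    (hpc : pc ≪ volume) {δ l : ℝ} (hl : 0 < l) (hlδ : l < δ) (hδ : δ ≤ 1)
    (hle : ENNReal.ofReal δ • pc ≤ π) :
    ∃ K : ℝ, 0 ≤ K ∧ ∀ q : ℕ, 0 < q →
      ENNReal.ofReal (l * Real.logb 2 q - K) ≤ entropy (quantize q) π := by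
  have h2 : 0 < Real.log 2 := Real.log_pos one_lt_two
  have hδ0 : 0 < δ := hl.trans hlδ
  obtain ⟨M, B, hB, hMB, hM⟩ := exists_density_bound pc hpc (t := ENNReal.ofReal (l / δ)) (by
    rw [ENNReal.ofReal_lt_one]
    exact (div_lt_one hδ0).2 hlδ)
  have hM0 : (0 : ℝ) < M := by
    rcases M.eq_zero_or_pos with rfl | h
    · have := hM Set.univ
      simp only [Set.univ_inter, Nat.cast_zero, zero_mul, nonpos_iff_eq_zero] at this
      simp [this] at hMB
    · exact_mod_cast h
  have hlogM : 0 ≤ Real.logb 2 M :=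
    Real.logb_nonneg one_lt_two (by exact_mod_cast (Nat.cast_pos.1 hM0))
  refine ⟨l * Real.logb 2 M + 1 / Real.log 2, by positivity, fun q hq => ?_⟩
  have hq' : (0 : ℝ) < q := Nat.cast_pos.2 hq
  have hmq := measurable_quantize q
  have : IsProbabilityMeasure (π.map (quantize q)) :=
    Measure.isProbabilityMeasure_map hmq.aemeasurable
  -- The part of π with density at most M: its total mass is at least l, while every cell receives
  -- at most M/q, so each unit of it contributes log₂ (q/M) bits up to the Gibbs loss.
  set μ : Measure ℝ := ENNReal.ofReal δ • pc.restrict B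
  set ν := μ.map (quantize q) with hν
  have hμπ : μ ≤ π := le_trans (by
    refine Measure.le_iff.2 fun s _ => ?_
    simp only [μ, Measure.smul_apply, smul_eq_mul]
    gcongr
    exact Measure.restrict_le_self) hle
  have : IsFiniteMeasure μ := isFiniteMeasure_of_le π hμπ
  have hνπ : ∀ a, ν.real {a} ≤ (π.map (quantize q)).real {a} := fun a => by
    refine ENNReal.toReal_mono (measure_ne_top _ _) ?_
    rw [hν, Measure.map_apply hmq (measurableSet_singleton _),
      Measure.map_apply hmq (measurableSet_singleton _)]
    exact hμπ _
  have hcell : ∀ a, ν.real {a} ≤ M / q := fun a => by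
    refine ENNReal.toReal_le_of_le_ofReal (by positivity) ?_
    rw [hν, Measure.map_apply hmq (measurableSet_singleton _), Measure.smul_apply,
      Measure.restrict_apply (hmq (measurableSet_singleton _)), smul_eq_mul]
    calc _ ≤ 1 * ((M : ℝ≥0∞) * ENNReal.ofReal (1 / q)) := by
          gcongr
          · exact ENNReal.ofReal_le_one.2 hδ
          · exact (hM _).trans (by gcongr; exact volume_quantize_preimage_le hq a)
      _ = _ := by
          rw [one_mul, ← ENNReal.ofReal_natCast, ← ENNReal.ofReal_mul hM0.le]
          congr 1
          ring
  have hνuniv : ENNReal.ofReal l ≤ ν Set.univ := by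
    rw [hν, Measure.map_apply hmq MeasurableSet.univ, Set.preimage_univ, Measure.smul_apply,
      Measure.restrict_apply_univ, smul_eq_mul]
    calc ENNReal.ofReal l = ENNReal.ofReal δ * ENNReal.ofReal (l / δ) := by
          rw [← ENNReal.ofReal_mul hδ0.le, mul_div_cancel₀ _ hδ0.ne']
      _ ≤ _ := by gcongr
  set L := Real.logb 2 (M / q : ℝ)⁻¹ with hL
  have hLeq : L = Real.logb 2 q - Real.logb 2 M := by
    rw [hL, inv_div, Real.logb_div hq'.ne' hM0.ne']
  have hmain : ENNReal.ofReal (l * L) ≤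
      entropy (quantize q) π + ENNReal.ofReal (1 / Real.log 2) := by
    calc ENNReal.ofReal (l * L) = ENNReal.ofReal L * ENNReal.ofReal l := by
          rw [ENNReal.ofReal_mul hl.le, mul_comm]
      _ ≤ ENNReal.ofReal L * ν Set.univ := by gcongr
      _ = ∑' a, ENNReal.ofReal L * ν {a} := by
          rw [tsum_mul_measure_singleton ν _ (countable_range_quantize q)
            (map_quantize_compl_range μ q), lintegral_const]
      _ ≤ ∑' a, (ENNReal.ofReal (-((π.map (quantize q)).real {a} *
            Real.logb 2 ((π.map (quantize q)).real {a}))) +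
            ENNReal.ofReal (1 / Real.log 2) * π.map (quantize q) {a}) := by
          refine ENNReal.tsum_le_tsum fun a => ?_
          have hνa : ν {a} = ENNReal.ofReal (ν.real {a}) := by simp [measureReal_def]
          have hπa : π.map (quantize q) {a} = ENNReal.ofReal ((π.map (quantize q)).real {a}) := by
            simp [measureReal_def]
          rw [hνa, hπa, mul_comm, ← ENNReal.ofReal_mul measureReal_nonneg,
            ← ENNReal.ofReal_mul (by positivity), one_div_mul_eq_div]
          exact (ENNReal.ofReal_le_ofReal (mul_logb_le_of_le measureReal_nonneg (hνπ a)
            measureReal_le_one (hcell a))).trans ENNReal.ofReal_add_le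
      _ ≤ _ := by
          rw [ENNReal.tsum_add]
          refine add_le_add le_rfl ?_
          rw [tsum_mul_measure_singleton _ _ (countable_range_quantize q)
            (map_quantize_compl_range π q), lintegral_const, measure_univ, mul_one]
  rw [show l * Real.logb 2 q - (l * Real.logb 2 M + 1 / Real.log 2) = l * L - 1 / Real.log 2 by
    rw [hLeq]; ring, ENNReal.ofReal_sub _ (by positivity)]
  exact tsub_le_iff_right.2 hmain

/-- The quantized entropy of a law of finite mean is at most `p log₂ q`, up to a constant, where
`p` is the mass outside a finite set. -/
lemma entropy_quantize_le (π : Measure ℝ) [IsProbabilityMeasure π]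
    (hπ : Integrable (fun x : ℝ => x) π) (F : Finset ℝ) :
    ∃ K : ℝ, 0 ≤ K ∧ ∀ q : ℕ, 0 < q → entropy (quantize q) π ≤
      ENNReal.ofReal (K + Real.logb 2 q * π.real (F : Set ℝ)ᶜ) := by
  -- One coordinate and no measurement: J consists of all unknown coordinates, so its mean size is
  -- the mass outside F.
  obtain ⟨K, hK, h⟩ := condEntropy_le_of_recovery_set (N := 1) (0 : Matrix (Fin 0) (Fin 1) ℝ) π hπ F
    (fun c => Finset.univ.filter fun i => c i = true) fun c x _ hx => by
      ext i
      refine hx i ?_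
      cases hc : c i
      · exact Or.inl rfl
      · exact Or.inr (Finset.mem_filter.2 ⟨Finset.mem_univ i, hc⟩)
  refine ⟨K, hK, fun q hq => ?_⟩
  have h1 := h q hq
  rw [condEntropy_of_subsingleton (Y := fun x => (0 : Matrix (Fin 0) (Fin 1) ℝ).mulVec x)
    (measurable_quantizeVec q)
    (Continuous.measurable (Continuous.matrix_mulVec continuous_const continuous_id))] at h1
  have h2 := (entropy_quantizeVec_ge π 1 q).trans h1
  rw [Nat.cast_one, one_mul] at h2
  refine h2.trans_eq (congrArg (fun t => ENNReal.ofReal (K + Real.logb 2 q * t)) ?_)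
  simp only [card_filter_eq_sum_toNat]
  rw [← Equiv.sum_comp (Equiv.funUnique (Fin 1) Bool).symm]
  simp [bernoulliWeight]

/-- A finite set F is null for pc, so π(Fᶜ) = δ + (1 - δ) pd(Fᶜ), and F can be chosen to carry
almost all of pd. -/
lemma exists_finset_compl_close {π pc pd : Measure ℝ} [IsProbabilityMeasure pc]
    [IsProbabilityMeasure pd] {δ : ℝ} (h0 : 0 ≤ δ) (h1 : δ ≤ 1) (hpc : pc ≪ volume) {s : Set ℝ}
    (hs : s.Countable) (hpd : pd sᶜ = 0)
    (hπ : π = ENNReal.ofReal δ • pc + ENNReal.ofReal (1 - δ) • pd) {κ : ℝ} (hκ : 0 < κ) :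
    ∃ F : Finset ℝ, |π.real (F : Set ℝ)ᶜ - δ| < κ := by
  obtain ⟨F, hF⟩ : ∃ F : Finset ℝ, 1 - κ < pd.real F := by
    have h := tsum_mul_measure_singleton pd (fun _ => 1) hs hpd
    simp only [one_mul, lintegral_one, measure_univ] at h
    rw [ENNReal.tsum_eq_iSup_sum] at h
    obtain ⟨F, hF⟩ := lt_iSup_iff.1
      (h.symm ▸ ENNReal.ofReal_lt_one.2 (by linarith) : ENNReal.ofReal (1 - κ) < _)
    refine ⟨F, ?_⟩
    rw [sum_measure_singleton] at hF
    by_contra! hle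
    exact absurd hF (not_lt.2 (by
      rw [← ofReal_measureReal]
      exact ENNReal.ofReal_le_ofReal hle))
  refine ⟨F, ?_⟩
  have hc : pc.real (F : Set ℝ)ᶜ = 1 := by
    rw [probReal_compl_eq_one_sub F.measurableSet, measureReal_def,
      hpc (F.countable_toSet.measure_zero _)]
    simp
  have hd := probReal_compl_eq_one_sub (μ := pd) F.measurableSet
  have hval : π.real (F : Set ℝ)ᶜ = δ + (1 - δ) * (1 - pd.real F) := by
    rw [hπ, measureReal_add_apply
      (ENNReal.mul_ne_top ENNReal.ofReal_ne_top (measure_ne_top _ _))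
      (ENNReal.mul_ne_top ENNReal.ofReal_ne_top (measure_ne_top _ _)), measureReal_ennreal_smul_apply,
      measureReal_ennreal_smul_apply, hc, hd, ENNReal.toReal_ofReal h0,
      ENNReal.toReal_ofReal (by linarith), mul_one]
  have hle : pd.real F ≤ 1 := measureReal_le_one
  rw [hval, add_sub_cancel_left, abs_of_nonneg (mul_nonneg (by linarith) (by linarith))]
  nlinarith

lemma tendsto_logb_natCast : Tendsto (fun q : ℕ => Real.logb 2 q) atTop atTop :=
  (Real.tendsto_logb_atTop one_lt_two).comp tendsto_natCast_atTop_atTop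

lemma tendsto_div_logb {u : ℕ → ℝ≥0∞} {δ : ℝ} (h0 : 0 ≤ δ)
    (hle : ∀ κ > 0, ∃ K : ℝ, 0 ≤ K ∧ ∀ q : ℕ, 0 < q →
      u q ≤ ENNReal.ofReal (K + (δ + κ) * Real.logb 2 q))
    (hge : ∀ κ > 0, ∃ K : ℝ, 0 ≤ K ∧ ∀ q : ℕ, 0 < q →
      ENNReal.ofReal ((δ - κ) * Real.logb 2 q - K) ≤ u q) :
    Tendsto (fun q => u q / ENNReal.ofReal (Real.logb 2 q)) atTop (𝓝 (ENNReal.ofReal δ)) := by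
  have hfin : ∀ q : ℕ, 0 < q → u q ≠ ⊤ := fun q hq => by
    obtain ⟨K, _, h⟩ := hle 1 one_pos
    exact ne_top_of_le_ne_top ENNReal.ofReal_ne_top (h q hq)
  have hreal : Tendsto (fun q => (u q).toReal / Real.logb 2 q) atTop (𝓝 δ) := by
    rw [Metric.tendsto_atTop']
    intro ε hε
    obtain ⟨K, hK, h1⟩ := hle (ε / 2) (by linarith)
    obtain ⟨K', hK', h2⟩ := hge (ε / 2) (by linarith)
    have hev := tendsto_logb_natCast.eventually (eventually_gt_atTop (2 * (K + K' + 1) / ε))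
    obtain ⟨n, hn⟩ := eventually_atTop.1 hev
    refine ⟨n + 1, fun q hq => ?_⟩
    have hq0 : 0 < q := by omega
    have hL := hn q (by omega)
    have hL0 : 0 < Real.logb 2 q := lt_trans (by positivity) hL
    rw [div_lt_iff₀ hε] at hL
    have e1 : (u q).toReal ≤ K + (δ + ε / 2) * Real.logb 2 q :=
      ENNReal.toReal_le_of_le_ofReal (by positivity) (h1 q hq0)
    have e2 : (δ - ε / 2) * Real.logb 2 q - K' ≤ (u q).toReal :=
      (ENNReal.ofReal_le_iff_le_toReal (hfin q hq0)).1 (h2 q hq0)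
    rw [Real.dist_eq, div_sub' hL0.ne', abs_div, abs_of_pos hL0, div_lt_iff₀ hL0, abs_lt]
    constructor <;> nlinarith
  refine (ENNReal.tendsto_ofReal hreal).congr' ?_
  filter_upwards [eventually_gt_atTop 1] with q hq
  have hL0 : 0 < Real.logb 2 q := Real.logb_pos one_lt_two (by exact_mod_cast hq)
  rw [ENNReal.ofReal_div_of_pos hL0, ENNReal.ofReal_toReal (hfin q (by omega))]

/-- The information dimension of a nonsingular law is the weight of its absolutely continuous
part. -/
lemma exists_weight (π : Measure ℝ) [IsProbabilityMeasure π] (hn : IsNonsingular π)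
    (hπ : Integrable (fun x : ℝ => x) π) :
    ∃ δ : ℝ, 0 ≤ δ ∧ δ ≤ 1 ∧ Tendsto (ridRatio π) atTop (𝓝 (ENNReal.ofReal δ)) ∧
      (∀ κ > 0, ∃ F : Finset ℝ, |π.real (F : Set ℝ)ᶜ - δ| < κ) ∧
      ∀ l, 0 < l → l < δ → ∃ K : ℝ, 0 ≤ K ∧ ∀ q : ℕ, 0 < q →
        ENNReal.ofReal (l * Real.logb 2 q - K) ≤ entropy (quantize q) π := by
  obtain ⟨δ, pc, pd, h0, h1, hpc, hpd, hac, ⟨s, hs, hs0⟩, hπeq⟩ := hn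
  have hF : ∀ κ > 0, ∃ F : Finset ℝ, |π.real (F : Set ℝ)ᶜ - δ| < κ := fun κ hκ =>
    exists_finset_compl_close h0 h1 hac hs hs0 hπeq hκ
  have hge : ∀ l, 0 < l → l < δ → ∃ K : ℝ, 0 ≤ K ∧ ∀ q : ℕ, 0 < q →
      ENNReal.ofReal (l * Real.logb 2 q - K) ≤ entropy (quantize q) π := fun l hl hlδ =>
    entropy_quantize_ge π pc hac hl hlδ h1 (by
      rw [hπeq]
      exact Measure.le_add_right le_rfl)
  refine ⟨δ, h0, h1, tendsto_div_logb h0 (fun κ hκ => ?_) (fun κ hκ => ?_), hF, hge⟩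
  · obtain ⟨F, hFκ⟩ := hF κ hκ
    obtain ⟨K, hK, h⟩ := entropy_quantize_le π hπ F
    refine ⟨K, hK, fun q hq => (h q hq).trans (ENNReal.ofReal_le_ofReal ?_)⟩
    have hlog : 0 ≤ Real.logb 2 q := Real.logb_nonneg one_lt_two (Nat.one_le_cast.2 hq)
    rw [abs_lt] at hFκ
    nlinarith
  · rcases lt_or_ge 0 (δ - κ) with h | h
    · exact hge _ h (by linarith)
    · refine ⟨0, le_rfl, fun q hq => ?_⟩
      have hlog : 0 ≤ Real.logb 2 q := Real.logb_nonneg one_lt_two (Nat.one_le_cast.2 hq)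
      rw [ENNReal.ofReal_of_nonpos]
      · exact zero_le
      · nlinarith

/-! ### Comparison of the entropies and conclusion -/

/-- The rows in `A` of a Hadamard matrix capture all but a fraction `ε` of the entropy if the
erasure probabilities of the other rows are small on average. -/
lemma limsup_condEntropy_div_entropy_le (π : Measure ℝ) [IsProbabilityMeasure π]
    (hπ : Integrable (fun x : ℝ => x) π) {δ ε : ℝ} (hδ : 0 < δ) (hε : 0 < ε)
    (hF : ∀ κ > 0, ∃ F : Finset ℝ, |π.real (F : Set ℝ)ᶜ - δ| < κ)
    (hge : ∀ l, 0 < l → l < δ → ∃ K : ℝ, 0 ≤ K ∧ ∀ q : ℕ, 0 < q →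
        ENNReal.ofReal (l * Real.logb 2 q - K) ≤ entropy (quantize q) π)
    (n : ℕ) (A : Finset (Fin (2 ^ n))) (hA : ∑ i ∈ Aᶜ, erasureProb n i δ < ε * (2 ^ n * δ)) :
    limsup (fun q : ℕ => condEntropy (quantizeVec q)
        (fun x => ((hadamard n).submatrix (A.orderEmbOfFin rfl) id).mulVec x)
        (iidLaw π (2 ^ n)) / entropy (quantizeVec q) (iidLaw π (2 ^ n))) atTop ≤
      ENNReal.ofReal ε := by
  have hN : (0 : ℝ) < 2 ^ n := by positivity
  set r : ℝ → ℝ := fun p => ∑ i ∈ Aᶜ, erasureProb n i p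
  have hr : Continuous r := continuous_finsetSum _ fun i _ => continuous_erasureProb n i
  -- The strict inequality in `hA` leaves room twice: to replace δ by l < δ in the lower bound for
  -- the entropy, and then, by continuity of r, to replace δ by p = π(Fᶜ) in the upper bound.
  obtain ⟨l, hl, hlδ⟩ : ∃ l, max 0 (r δ / (ε * 2 ^ n)) < l ∧ l < δ := by
    refine exists_between (max_lt hδ ?_)
    rw [div_lt_iff₀ (by positivity)]
    linarith
  have hl0 : 0 < l := (le_max_left _ _).trans_lt hl
  have hrl : r δ < ε * 2 ^ n * l := by
    have := (le_max_right _ _).trans_lt hl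
    rw [div_lt_iff₀ (by positivity)] at this
    linarith
  obtain ⟨κ, hκ, hκr⟩ := Metric.eventually_nhds_iff.1
    ((hr.tendsto δ).eventually (gt_mem_nhds hrl))
  obtain ⟨F, hFκ⟩ := hF κ hκ
  set p := π.real (F : Set ℝ)ᶜ
  have hrp : r p < ε * 2 ^ n * l := hκr hFκ
  choose J hJ hJcard using exists_hadamard_recovery_set n A
  obtain ⟨K, hK, hup⟩ := condEntropy_le_of_recovery_set
    ((hadamard n).submatrix (A.orderEmbOfFin rfl) id) π hπ F J hJ
  obtain ⟨K', hK', hlow⟩ := hge l hl0 hlδ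
  have hsum : ∑ c, bernoulliWeight p c * ((J c).card : ℝ) ≤ r p := by
    calc ∑ c, bernoulliWeight p c * ((J c).card : ℝ)
        ≤ ∑ c, bernoulliWeight p c * ∑ i ∈ Aᶜ, ((erased n i c).toNat : ℝ) := by
          refine Finset.sum_le_sum fun c _ => mul_le_mul_of_nonneg_left (by exact_mod_cast hJcard c)
            (bernoulliWeight_nonneg measureReal_nonneg measureReal_le_one c)
      _ = r p := by
          simp only [Finset.mul_sum, r]
          rw [Finset.sum_comm]
          exact Finset.sum_congr rfl fun i _ => sum_bernoulliWeight_erased n i p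
  refine limsup_le_of_le (by isBoundedDefault) ?_
  -- Beyond this threshold the gap ε 2ⁿ l - r p, multiplied by log₂ q, absorbs both additive
  -- constants.
  have hev := tendsto_logb_natCast.eventually
    (eventually_ge_atTop ((K + ε * 2 ^ n * K') / (ε * 2 ^ n * l - r p)))
  filter_upwards [hev, eventually_gt_atTop 0] with q hq hq0
  have hlog : 0 ≤ Real.logb 2 q := Real.logb_nonneg one_lt_two (Nat.one_le_cast.2 hq0)
  rw [div_le_iff₀ (by linarith)] at hq
  refine ENNReal.div_le_of_le_mul ?_
  calc _ ≤ ENNReal.ofReal (K + Real.logb 2 q * ∑ c, bernoulliWeight p c * (J c).card) := hup q hq0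
    _ ≤ ENNReal.ofReal (ε * (2 ^ n * (l * Real.logb 2 q - K'))) := by
        refine ENNReal.ofReal_le_ofReal ?_
        have := mul_le_mul_of_nonneg_left hsum hlog
        linarith
    _ = ENNReal.ofReal ε * (((2 ^ n : ℕ) : ℝ≥0∞) * ENNReal.ofReal (l * Real.logb 2 q - K')) := by
        rw [ENNReal.ofReal_mul hε.le, ENNReal.ofReal_mul hN.le, ← ENNReal.ofReal_natCast]
        push_cast
        rfl
    _ ≤ ENNReal.ofReal ε * (((2 ^ n : ℕ) : ℝ≥0∞) * entropy (quantize q) π) := by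
        gcongr
        exact hlow q hq0
    _ ≤ _ := by
        gcongr
        exact entropy_quantizeVec_ge π (2 ^ n) q

end RIDPolar

theorem mainTheorem10 (Pi : Set (ProbabilityMeasure ℝ))
    (h_nonsing : ∀ π ∈ Pi, RIDPolar.IsNonsingular (π : Measure ℝ))
    (h_moment : ∀ π ∈ Pi, Integrable (fun x : ℝ => x ^ 2) (π : Measure ℝ))
    (h_pos : ∀ π ∈ Pi, 0 < RIDPolar.rid (π : Measure ℝ)) :
    (∀ π ∈ Pi, Tendsto (RIDPolar.ridRatio (π : Measure ℝ)) atTop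
      (𝓝 (RIDPolar.rid (π : Measure ℝ)))) ∧
    ∀ ε : ℝ, 0 < ε →
      ∃ (m : ℕ → ℕ) (Φ : ∀ n, Matrix (Fin (m n)) (Fin (2 ^ n)) ℝ),
        (∀ n, RIDPolar.IsPartialHadamard n (Φ n)) ∧
        RIDPolar.measurementRate Φ = ⨆ π ∈ Pi, RIDPolar.rid (π : Measure ℝ) ∧
        RIDPolar.IsREPClass Φ ε Pi (⨆ π ∈ Pi, RIDPolar.rid (π : Measure ℝ)) := by
  have h_int : ∀ π ∈ Pi, Integrable (fun x : ℝ => x) (π : Measure ℝ) := fun π hπ =>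
    ((memLp_two_iff_integrable_sq measurable_id.aestronglyMeasurable).2
      (h_moment π hπ)).integrable one_le_two
  have hw := fun π (hπ : π ∈ Pi) =>
    RIDPolar.exists_weight (π : Measure ℝ) (h_nonsing π hπ) (h_int π hπ)
  refine ⟨fun π hπ => ?_, fun ε hε => ?_⟩
  · obtain ⟨δ, _, _, hlim, _⟩ := hw π hπ
    rwa [RIDPolar.rid, hlim.limsup_eq]
  · set d := ⨆ π ∈ Pi, RIDPolar.rid (π : Measure ℝ)
    have hd1 : d ≤ 1 := iSup₂_le fun π hπ => by
      obtain ⟨δ, _, h1, hlim, _⟩ := hw π hπ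
      rw [RIDPolar.rid, hlim.limsup_eq]
      exact ENNReal.ofReal_le_one.2 h1
    have hdtop : d ≠ ⊤ := ne_top_of_le_ne_top ENNReal.one_ne_top hd1
    -- The rows depend only on d and ε, not on the law. An empty class gives d = 0.
    obtain ⟨A, hA, hAr⟩ := RIDPolar.exists_rows (d := d.toReal) ENNReal.toReal_nonneg
      (ENNReal.toReal_le_of_le_ofReal zero_le_one (by simpa using hd1)) hε
    have hrate : RIDPolar.measurementRate (fun n =>
        (RIDPolar.hadamard n).submatrix ((A n).orderEmbOfFin rfl) id) = d := by
      refine Tendsto.limsup_eq ?_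
      have := ENNReal.tendsto_ofReal hA
      rw [ENNReal.ofReal_toReal hdtop] at this
      refine this.congr fun n => ?_
      rw [ENNReal.ofReal_div_of_pos (by positivity), ENNReal.ofReal_natCast]
      congr 1
      rw [← ENNReal.ofReal_natCast]
      push_cast
      rfl
    refine ⟨fun n => (A n).card, fun n =>
      (RIDPolar.hadamard n).submatrix ((A n).orderEmbOfFin rfl) id,
      fun n => ⟨(A n).orderEmbOfFin rfl, rfl⟩, hrate, fun π hπ => ⟨fun n => ?_, hrate⟩⟩
    obtain ⟨δ, _, _, hlim, hF, hge⟩ := hw π hπ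
    have hrid : RIDPolar.rid (π : Measure ℝ) = ENNReal.ofReal δ := hlim.limsup_eq
    have hδ : 0 < δ := by
      have := h_pos π hπ
      rwa [hrid, ENNReal.ofReal_pos] at this
    have hδd : δ ≤ d.toReal := by
      rw [← ENNReal.ofReal_le_iff_le_toReal hdtop, ← hrid]
      exact le_iSup₂ (f := fun (π : ProbabilityMeasure ℝ) (_ : π ∈ Pi) =>
        RIDPolar.rid (π : Measure ℝ)) π hπ
    exact RIDPolar.limsup_condEntropy_div_entropy_le (π : Measure ℝ) (h_int π hπ) hδ hε hF hge n
      (A n) (hAr n δ hδ hδd)
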